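/- **Model.** A malleable task $T_i$ has a workload $D_i$, a deadline $d_i$ and a parallelism bound $k_i$, all positive integers; $len_i=\lceil D_i/k_i\rceil$. Let $\mathcal T$ be a finite set of tasks, $\tau_0=0$, and let $\tau_1<\dots<\tau_L$ be the distinct deadlines of the tasks in $\mathcal T$. Let $\mathcal S\subseteq\mathcal T$ and let $C\ge 0$ be the number of machines. A feasible schedule of $\mathcal S$ on $C$ machines assigns to each $T_i\in\mathcal S$ and each time slot $t\in\{1,2,\dots\}$ a number $y_i(t)\in\{0,\dots,k_i\}$ of machines, with $y_i(t)=0$ for $t>d_i$, such that $\sum_{t\le d_i}y_i(t)\ge D_i$ for every $T_i\in\mathcal S$ and $W(t)=\sum_{T_i\in\mathcal S}y_i(t)\le C$ for every $t$. Write $\overline W(t)=C-W(t)$. **Boundary condition.** For $0\le m\le L$ let $\lambda_m(\mathcal S)$ be the sum over $T_j\in\mathcal S$ of $D_j$ if $len_j\le d_j-\tau_{L-m}$, and of $k_j\cdot\max\{0,d_j-\tau_{L-m}\}$ otherwise. Put $\lambda^C_0(\mathcal S)=0$, $\lambda^C_m(\mathcal S)=\lambda^C_{m-1}(\mathcal S)+\min\{\lambda_m(\mathcal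 S)-\lambda^C_{m-1}(\mathcal S),\,C(\tau_{L-m+1}-\tau_{L-m})\}$ for $1\le m\le L$, and $\mu^C_m(\mathcal S)=\sum_{T_j\in\mathcal S}D_j-\lambda^C_{L-m}(\mathcal S)$. The boundary condition is: $\mu^C_m(\mathcal S)\le C\tau_m$ for all $m\in\{0,1,\dots,L\}$. **Algorithm LDF($\mathcal S$).** Start with $y_i(t)=0$ for all $i$ and $t$. For $m=L,L-1,\dots,1$, take the tasks $T_i\in\mathcal S$ with deadline $\tau_m$ in any order and do the following three steps for each. 1. *Fully-Utilize.* For $t=d_i,\dots,1$ set $y_i(t)\leftarrow\min\{k_i,\;D_i-\sum_{\bar t=t+1}^{d_i}y_i(\bar t),\;\overline W(t)\}$. 2. *Fully-Allocate.* Let $\Omega=D_i-\sum_{\bar t\le d_i}y_i(\bar t)$. For $t=d_i,\dots,1$, as long as $\Omega>0$: let $\Delta=\min\{k_i-y_i(t),\Omega\}$; if $\Delta>0$, call Routine$(\Delta,0)$ at $t$, then decrease $\Omega$ by $\overline W(t)$ and increase $y_i(t)$ by $\overline W(t)$ (both with the value of $\overline W(t)$ on return from Routine). 3. *AllocateRLM.*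 For $t=d_i,\dots,1$, as long as $\sum_{\bar t<t}y_i(\bar t)>0$: let $\Delta=\min\{k_i-y_i(t),\sum_{\bar t<t}y_i(\bar t)\}$; if $\Delta>0$, call Routine$(\Delta,1)$ at $t$, let $\theta=\overline W(t)$, increase $y_i(t)$ by $\theta$, and remove $\theta$ units from the allocation of $T_i$, starting from its earliest slots. *Routine$(\Delta,\eta)$ at $t$* repeats the following while $\overline W(t)<\Delta$. Let $t'$ be the latest slot in $\{1,\dots,t-1\}$ with $\overline W(t')>0$, and stop if there is none. If $\eta=1$ and $\sum_{\bar t<t'}y_i(\bar t)\le\overline W(t)$, stop. Otherwise choose any task $T_{i'}$ in $\mathcal S$ with $y_{i'}(t)>y_{i'}(t')$ (stop if there is none), decrease $y_{i'}(t)$ by $1$ and increase $y_{i'}(t')$ by $1$. **Theorem.** (a) (Necessity.) If $\mathcal S$ has any feasible schedule on $C$ machines, then the boundary condition holds. (b) LDF($\mathcal S$) produces a feasible schedule of $\mathcal S$ on $C$ machines if and only if the boundary condition holds. This is true both if "produces" means for every resolution of the free choices of the algorithm and if it means for at least one. Hence LDF is optimal: whenever $\mathcal S$ has a feasible schedule on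 $C$ machines, LDF($\mathcal S$) finds one. (c) (Running time.) For all bounds $d$ and $k$ there is a constant $K=K(d,k)$ such that, if all tasks in $\mathcal T$ have deadline at most $d$ and parallelism bound at most $k$ and $\mathcal S\neq\emptyset$, then every run of LDF($\mathcal S$) takes at most $K|\mathcal S|^2$ time. Here each access to a table entry $y_i(t)$, each arithmetic operation, each comparison and each loop pass takes a bounded number of time units, all sums and searches are carried out by loops, and the sorted list $\tau_1<\dots<\tau_L$ is part of the input. -/

import Mathlib

namespace Malleable

/-! ### Tasks, schedules and the boundary condition -/

/-- A malleable task: workload `D`, deadline `d` and parallelism bound `k`, all positive integers. -/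
structure Task where
  workload : ℕ
  deadline : ℕ
  bound : ℕ
  workload_pos : 0 < workload
  deadline_pos : 0 < deadline
  bound_pos : 0 < bound

/-- The minimal length of execution time, `⌈D / k⌉`. -/
def Task.len (a : Task) : ℕ := a.workload ⌈/⌉ a.bound

/-- An allocation table: `y i t` is the number of machines given to task `i` at time slot `t`. -/
abbrev Table (n : ℕ) : Type := Fin n → ℕ → ℕ

/-- `y` is a feasible schedule of the tasks in `S` on `C` machines. The time slots are the
positive integers. -/
structure Feasible {n : ℕ} (T : Fin n → Task) (S : Finset (Fin n)) (C : ℕ) (y : Table n) :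
    Prop where
  /-- a task uses machines only in the time slots `1, …, d_i` -/
  window : ∀ i ∈ S, ∀ t, t ∉ Finset.Icc 1 (T i).deadline → y i t = 0
  /-- the parallelism bound is respected -/
  parallelism : ∀ i ∈ S, ∀ t, y i t ≤ (T i).bound
  /-- every task is fully allocated by its deadline -/
  completed : ∀ i ∈ S, (T i).workload ≤ ∑ t ∈ Finset.Icc 1 (T i).deadline, y i t
  /-- at most `C` machines are in use at every time slot -/
  capacity : ∀ t, ∑ i ∈ S, y i t ≤ C

/-- The set of the deadlines of all tasks. -/
def deadlines {n : ℕ} (T : Fin n → Task) : Finset ℕ :=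
  Finset.univ.image fun i => (T i).deadline

/-- The number `L` of distinct deadlines. -/
def numDeadlines {n : ℕ} (T : Fin n → Task) : ℕ := (deadlines T).card

/-- `τ_0 = 0`, and `τ_1 < ⋯ < τ_L` are the distinct deadlines in increasing order. -/
def tau {n : ℕ} (T : Fin n → Task) (m : ℕ) : ℕ :=
  (0 :: (deadlines T).sort (· ≤ ·)).getD m 0

/-- `λ_m(S)`: the amount of resource that `S` can use in the slots `τ_{L-m}+1, …, τ_L` when the
number of machines is unlimited. The truncated difference is the number of those slots
that lie before the deadline of `j`; a task whose deadline is at most `τ_{L-m}` contributes `0`. -/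
def lam {n : ℕ} (T : Fin n → Task) (S : Finset (Fin n)) (m : ℕ) : ℕ :=
  ∑ j ∈ S,
    if (T j).len ≤ (T j).deadline - tau T (numDeadlines T - m) then (T j).workload
    else (T j).bound * ((T j).deadline - tau T (numDeadlines T - m))

/-- `λ_m^C(S)`: the same amount on `C` machines. For `m < L` one has
`λ_m^C(S) ≤ λ_m(S) ≤ λ_{m+1}(S)` and `τ_{L-(m+1)} < τ_{L-m}`, so both differences are exact. -/
def lamC {n : ℕ} (T : Fin n → Task) (S : Finset (Fin n)) (C : ℕ) : ℕ → ℕ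
  | 0 => 0
  | m + 1 => lamC T S C m +
      min (lam T S (m + 1) - lamC T S C m)
        (C * (tau T (numDeadlines T - m) - tau T (numDeadlines T - (m + 1))))

/-- `μ_m^C(S)`: the workload that remains for the slots `1, …, τ_m`. The difference is exact, as
`λ_m^C(S)` never exceeds the total workload. -/
def mu {n : ℕ} (T : Fin n → Task) (S : Finset (Fin n)) (C : ℕ) (m : ℕ) : ℕ :=
  ∑ j ∈ S, (T j).workload - lamC T S C (numDeadlines T - m)

/-- The boundary condition: `μ_m^C(S) ≤ C τ_m` for `m = 0, 1, …, L`. -/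
def Boundary {n : ℕ} (T : Fin n → Task) (S : Finset (Fin n)) (C : ℕ) : Prop :=
  ∀ m ≤ numDeadlines T, mu T S C m ≤ C * tau T m

/-! ### Nondeterministic programs on an allocation table, with a clock

Reading or writing one entry of the table costs one unit of time; every pass of a loop,
comparison and arithmetic operation is charged by `tick`. -/

/-- The result of one run of a program: returned value, final table, elapsed time. -/
@[ext]
structure Outcome (n : ℕ) (α : Type) where
  val : α
  table : Table n
  time : ℕ

/-- A program: the set of the possible outcomes, as a function of the initial table. There are
several outcomes when the algorithm leaves a choice open. -/
def Prog (n : ℕ) (α : Type) : Type := Table n → Set (Outcome n α)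

/-- Sequential composition; times add up. -/
instance (n : ℕ) : Monad (Prog n) where
  pure a := fun y => {⟨a, y, 0⟩}
  bind p f := fun y =>
    {r | ∃ r₁ ∈ p y, ∃ r₂ ∈ f r₁.val r₁.table, r = ⟨r₂.val, r₂.table, r₁.time + r₂.time⟩}

/-- Spend `c` units of time. -/
def tick {n : ℕ} (c : ℕ) : Prog n Unit := fun y => {⟨(), y, c⟩}

/-- Read `y_i(t)`. -/
def read {n : ℕ} (i : Fin n) (t : ℕ) : Prog n ℕ := fun y => {⟨y i t, y, 1⟩}

/-- Assign `y_i(t) ← v`. -/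
def write {n : ℕ} (i : Fin n) (t v : ℕ) : Prog n Unit := fun y =>
  {⟨(), Function.update y i (Function.update (y i) t v), 1⟩}

/-- Fix an arbitrary order of the elements of `A`. The loops that run through
the list are charged per element. -/
def listing {n : ℕ} (A : Finset (Fin n)) : Prog n (List (Fin n)) := fun y =>
  {r | r.val.Nodup ∧ r.val.toFinset = A ∧ r.table = y ∧ r.time = 0}

/-- `∑ y_i(t)` over the tasks `i` of a list. -/
def sumTasks {n : ℕ} (t : ℕ) : List (Fin n) → Prog n ℕ
  | [] => do
      tick 1
      pure 0
  | i :: l => do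
      tick 2
      let v ← read i t
      let s ← sumTasks t l
      pure (v + s)

/-- `W̄(t) = C - W(t)`, the number of idle machines at `t`. -/
def avail {n : ℕ} (S : Finset (Fin n)) (C t : ℕ) : Prog n ℕ := do
  let l ← listing S
  let w ← sumTasks t l
  tick 1
  pure (C - w)

/-- `y_i(a+1) + ⋯ + y_i(a+r)`. -/
def sumSlots {n : ℕ} (i : Fin n) (a : ℕ) : ℕ → Prog n ℕ
  | 0 => do
      tick 1
      pure 0
  | r + 1 => do
      tick 2
      let s ← sumSlots i a r
      let v ← read i (a + (r + 1))
      pure (s + v)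

/-- The latest time slot in `1, …, u` with an idle machine, if there is one. -/
def latestIdle {n : ℕ} (S : Finset (Fin n)) (C : ℕ) : ℕ → Prog n (Option ℕ)
  | 0 => do
      tick 1
      pure none
  | u + 1 => do
      tick 2
      let w ← avail S C (u + 1)
      if 0 < w then pure (some (u + 1)) else latestIdle S C u

/-- The first task `j` of a list with `y_j(t) > y_j(t')`, if there is one. -/
def findTask {n : ℕ} (t t' : ℕ) : List (Fin n) → Prog n (Option (Fin n))
  | [] => do
      tick 1
      pure none
  | j :: l => do
      tick 2
      let a ← read j t
      let b ← read j t'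
      if b < a then pure (some j) else findTask t t' l

/-! ### The algorithm -/

/-- The loop `while W̄(t) < Δ` of `Routine`, run for at most `fuel` passes. The loop moves
allocations of other tasks from `t` to the latest earlier slot with an idle machine. With
`checkEarlier` it also stops once at most `W̄(t)` units of task `i` lie before that slot. -/
def routineLoop {n : ℕ} (S : Finset (Fin n)) (C : ℕ) (i : Fin n) (t Δ : ℕ)
    (checkEarlier : Bool) : ℕ → Prog n Unit
  | 0 => pure ()
  | fuel + 1 => do
      tick 1
      let w ← avail S C t
      if w < Δ then do
        let o ← latestIdle S C (t - 1)
        match o with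
        | none => pure ()
        | some t' => do
            let s ← sumSlots i 0 (t' - 1)
            tick 2
            if checkEarlier = true ∧ s ≤ w then pure ()
            else do
              let l ← listing S
              let c ← findTask t t' l
              match c with
              | none => pure ()
              | some j => do
                  tick 2
                  let a ← read j t
                  write j t (a - 1)
                  let b ← read j t'
                  write j t' (b + 1)
                  routineLoop S C i t Δ checkEarlier fuel
      else pure ()

/-- `Routine`. Every complete pass of the loop raises `W̄(t)` by one, so the test `W̄(t) < Δ` fails
after at most `Δ` passes and the limit on the number of passes never interferes. -/
def routine {n : ℕ} (S : Finset (Fin n)) (C : ℕ) (i : Fin n) (t Δ : ℕ)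
    (checkEarlier : Bool) : Prog n Unit :=
  routineLoop S C i t Δ checkEarlier (Δ + 1)

/-- `Fully-Utilize(i)`, for the slots `t, t-1, …, 1`. -/
def fullyUtilize {n : ℕ} (T : Fin n → Task) (S : Finset (Fin n)) (C : ℕ) (i : Fin n) :
    ℕ → Prog n Unit
  | 0 => tick 1
  | t + 1 => do
      let s ← sumSlots i (t + 1) ((T i).deadline - (t + 1))
      let w ← avail S C (t + 1)
      tick 4
      write i (t + 1) (min (T i).bound (min ((T i).workload - s) w))
      fullyUtilize T S C i t

/-- The loop `while Ω > 0` of `Fully-Allocate(i)`, for the slots `t, t-1, …, 1`; it gives up when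
there is no slot left. -/
def fullyAllocateLoop {n : ℕ} (T : Fin n → Task) (S : Finset (Fin n)) (C : ℕ) (i : Fin n) :
    ℕ → ℕ → Prog n Unit
  | 0, _ => tick 1
  | t + 1, Ω => do
      tick 1
      if 0 < Ω then do
        let v ← read i (t + 1)
        let Δ := min ((T i).bound - v) Ω
        tick 4
        if 0 < Δ then do
          routine S C i (t + 1) Δ false
          let w ← avail S C (t + 1)
          let v' ← read i (t + 1)
          tick 2
          write i (t + 1) (v' + w)
          fullyAllocateLoop T S C i t (Ω - w)
        else fullyAllocateLoop T S C i t Ω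
      else pure ()

/-- `Fully-Allocate(i)`. -/
def fullyAllocate {n : ℕ} (T : Fin n → Task) (S : Finset (Fin n)) (C : ℕ) (i : Fin n) :
    Prog n Unit := do
  let s ← sumSlots i 0 (T i).deadline
  tick 1
  fullyAllocateLoop T S C i (T i).deadline ((T i).workload - s)

/-- The slot `u' ≥ u` at which the running total of `y_i`, starting from the value `acc` just
before slot `u`, first reaches `θ`, with the running total just before `u'`; at most `r` slots
are inspected. -/
def findSlot {n : ℕ} (i : Fin n) (θ : ℕ) : ℕ → ℕ → ℕ → Prog n (ℕ × ℕ)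
  | 0, u, acc => do
      tick 1
      pure (u, acc)
  | r + 1, u, acc => do
      tick 3
      let v ← read i u
      if θ ≤ acc + v then pure (u, acc) else findSlot i θ r (u + 1) (acc + v)

/-- Assign `y_i(t̄) ← 0` for `t̄ = 1, …, t`. -/
def clearSlots {n : ℕ} (i : Fin n) : ℕ → Prog n Unit
  | 0 => tick 1
  | t + 1 => do
      tick 1
      write i (t + 1) 0
      clearSlots i t

/-- Remove `θ` units of the allocation of task `i`, starting from the earliest slots. -/
def removeEarliest {n : ℕ} (T : Fin n → Task) (i : Fin n) (θ : ℕ) : Prog n Unit := do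
  tick 1
  if 0 < θ then do
    let p ← findSlot i θ (T i).deadline 1 0
    let v ← read i p.1
    tick 3
    write i p.1 (v - (θ - p.2))
    clearSlots i (p.1 - 1)
  else pure ()

/-- `AllocateRLM(i, 1)`, for the slots `t, t-1, …, 1`. -/
def allocateRLM {n : ℕ} (T : Fin n → Task) (S : Finset (Fin n)) (C : ℕ) (i : Fin n) :
    ℕ → Prog n Unit
  | 0 => tick 1
  | t + 1 => do
      let s ← sumSlots i 0 t
      tick 1
      if 0 < s then do
        let v ← read i (t + 1)
        let Δ := min ((T i).bound - v) s
        tick 3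
        if 0 < Δ then do
          routine S C i (t + 1) Δ true
          let θ ← avail S C (t + 1)
          let v' ← read i (t + 1)
          tick 1
          write i (t + 1) (v' + θ)
          removeEarliest T i θ
          allocateRLM T S C i t
        else allocateRLM T S C i t
      else pure ()

/-- `Allocate-B(i)`. -/
def allocateB {n : ℕ} (T : Fin n → Task) (S : Finset (Fin n)) (C : ℕ) (i : Fin n) :
    Prog n Unit := do
  fullyUtilize T S C i (T i).deadline
  fullyAllocate T S C i
  allocateRLM T S C i (T i).deadline

/-- The tasks of a list that have deadline `d`. -/
def withDeadline {n : ℕ} (T : Fin n → Task) (d : ℕ) : List (Fin n) → Prog n (List (Fin n))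
  | [] => do
      tick 1
      pure []
  | i :: l => do
      tick 3
      let r ← withDeadline T d l
      if (T i).deadline = d then pure (i :: r) else pure r

/-- Call `Allocate-B` for the tasks of a list, one after the other. -/
def allocateAll {n : ℕ} (T : Fin n → Task) (S : Finset (Fin n)) (C : ℕ) :
    List (Fin n) → Prog n Unit
  | [] => tick 1
  | i :: l => do
      tick 2
      allocateB T S C i
      allocateAll T S C l

/-- The main loop of `LDF(S)`: for `m, m-1, …, 1`, the tasks of `S` with deadline `τ_m` are
allocated in an arbitrary order. -/
def ldfLoop {n : ℕ} (T : Fin n → Task) (S : Finset (Fin n)) (C : ℕ) : ℕ → Prog n Unit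
  | 0 => tick 1
  | m + 1 => do
      tick 2
      let l ← listing S
      let b ← withDeadline T (tau T (m + 1)) l
      allocateAll T S C b
      ldfLoop T S C m

/-- The outcomes of the runs of `LDF(S)` on `C` machines, from the empty allocation table. -/
def ldfRuns {n : ℕ} (T : Fin n → Task) (S : Finset (Fin n)) (C : ℕ) : Set (Outcome n Unit) :=
  ldfLoop T S C (numDeadlines T) fun _ _ => 0

end Malleable

/-!
The boundary condition says that `forced T S u ≤ C * u` for every slot `u`, where `forced T S u` is
the work that does not fit after `u` because of the deadlines and the parallelism bounds
(`boundary_of_forced_le`, `forced_le_of_boundary`). The definition mentions only the slots `τ_m`,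
but between two consecutive deadlines the forced work is a convex function of `u`. In this form
necessity is obvious (`Feasible.forced_le`).

Sufficiency rests on the invariant `Packed`: if slot `s` has an idle machine, then every task either
runs at full parallelism from `s` to its deadline or has no work before `s`. Suppose that
`Fully-Allocate` cannot complete task `i`. Then an initial range of slots is fully used, and `i` runs
at full parallelism after it. Extend the range to the last slot `u` before the first idle machine.
All other tasks do at most their forced work in `1, …, u`, and `i` does less than that; but together
they do `C u` units, so the forced work exceeds `C u` (`InProgress.complete_of_full`).

The passes of `Routine` are exchanges: a unit of a task `j` goes from `t` to the latest earlier slot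
`t'` with an idle machine, and task `i` gets the machine at `t`. As `j` does not run at full
parallelism in `t'`, it has no work before `t'`, and the exchange keeps it packed
(`InProgress.exchange`). A task `j ≠ i` to be moved exists, since `i` runs at full parallelism in
`t'` (`ensures_routineLoop`). `AllocateRLM` packs the task `i` itself. The units that it removes come
from the earliest slots, which already have idle machines because the load does not decrease up to
the current deadline; so the other tasks stay packed (`InProgress.trim`). This monotonicity is where
the order of the deadlines matters.

The running time is bounded by adding up the costs of all loops. The number of passes of each loop
is bounded in terms of `d` and `k`, except for the loops through the tasks; at most two of
these are nested (`time_le`).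
-/

namespace Malleable

/-! ### Reasoning about programs -/

/-- Every run of `p` from the table `y` ends with a value and a table that satisfy `Q`. -/
def Ensures {n : ℕ} {α : Type} (p : Prog n α) (y : Table n) (Q : α → Table n → Prop) : Prop :=
  ∀ r ∈ p y, Q r.val r.table

/-- From every table `p` has a run, and all its runs take time at most `c` and return a value that
satisfies `Q`. -/
def Runs {n : ℕ} {α : Type} (p : Prog n α) (c : ℕ) (Q : α → Prop) : Prop :=
  ∀ y, (p y).Nonempty ∧ ∀ r ∈ p y, r.time ≤ c ∧ Q r.val

section Ensures

variable {n : ℕ} {α β : Type} {y : Table n}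

theorem ensures_pure {a : α} {Q : α → Table n → Prop} :
    Ensures (pure a : Prog n α) y Q ↔ Q a y := by
  simp [Ensures, pure]

theorem ensures_bind {p : Prog n α} {f : α → Prog n β} {Q : β → Table n → Prop} :
    Ensures (p >>= f) y Q ↔ Ensures p y fun a y' => Ensures (f a) y' Q := by
  constructor
  · intro h r hr r' hr'
    exact h ⟨r'.val, r'.table, r.time + r'.time⟩ ⟨r, hr, r', hr', rfl⟩
  · rintro h _ ⟨r, hr, r', hr', rfl⟩
    exact h r hr r' hr'

theorem Ensures.mono {p : Prog n α} {Q R : α → Table n → Prop} (h : Ensures p y Q)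
    (hQR : ∀ a y', Q a y' → R a y') : Ensures p y R :=
  fun r hr => hQR _ _ (h r hr)

theorem ensures_tick {c : ℕ} {Q : Unit → Table n → Prop} :
    Ensures (tick c) y Q ↔ Q () y := by
  simp [Ensures, tick]

theorem ensures_read {i : Fin n} {t : ℕ} {Q : ℕ → Table n → Prop} :
    Ensures (read i t) y Q ↔ Q (y i t) y := by
  simp [Ensures, read]

theorem ensures_write {i : Fin n} {t v : ℕ} {Q : Unit → Table n → Prop} :
    Ensures (write i t v) y Q ↔ Q () (Function.update y i (Function.update (y i) t v)) := by
  simp [Ensures, write]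

theorem ensures_listing {A : Finset (Fin n)} {Q : List (Fin n) → Table n → Prop} :
    Ensures (listing A) y Q ↔ ∀ l : List (Fin n), l.Nodup → l.toFinset = A → Q l y := by
  constructor
  · intro h l h₁ h₂
    exact h ⟨l, y, 0⟩ ⟨h₁, h₂, rfl, rfl⟩
  · rintro h r ⟨h₁, h₂, h₃, -⟩
    rw [h₃]
    exact h _ h₁ h₂

theorem ensures_sumTasks {t : ℕ} {l : List (Fin n)} {Q : ℕ → Table n → Prop} :
    Ensures (sumTasks t l) y Q ↔ Q (l.map fun i => y i t).sum y := by
  induction l generalizing Q with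
  | nil => simp [sumTasks, ensures_bind, ensures_tick, ensures_pure]
  | cons i l ih => simp [sumTasks, ensures_bind, ensures_tick, ensures_pure, ensures_read, ih]

/-- The number `W(t)` of machines in use at `t`. -/
def used (S : Finset (Fin n)) (y : Table n) (t : ℕ) : ℕ := ∑ i ∈ S, y i t

/-- The units of task `i` in the slots `1, …, t - 1`. -/
def before (y : Table n) (i : Fin n) (t : ℕ) : ℕ := ∑ v ∈ Finset.Ico 1 t, y i v

theorem ensures_avail {S : Finset (Fin n)} {C t : ℕ} {Q : ℕ → Table n → Prop} :
    Ensures (avail S C t) y Q ↔ Q (C - used S y t) y := by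
  have key : ∀ l : List (Fin n), l.Nodup → l.toFinset = S →
      (l.map fun i => y i t).sum = used S y t := by
    rintro l hl rfl
    exact (List.sum_toFinset _ hl).symm
  simp only [avail, ensures_bind, ensures_tick, ensures_pure, ensures_listing, ensures_sumTasks]
  constructor
  · intro h
    simpa [key _ S.nodup_toList S.toList_toFinset] using h _ S.nodup_toList S.toList_toFinset
  · intro h l h₁ h₂
    rwa [key l h₁ h₂]

theorem ensures_sumSlots {i : Fin n} {a r : ℕ} {Q : ℕ → Table n → Prop} :
    Ensures (sumSlots i a r) y Q ↔ Q (∑ v ∈ Finset.Ico (a + 1) (a + r + 1), y i v) y := by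
  induction r generalizing Q with
  | zero => simp [sumSlots, ensures_bind, ensures_tick, ensures_pure]
  | succ r ih =>
    rw [← add_assoc, Finset.sum_Ico_succ_top (by omega)]
    simp [sumSlots, ensures_bind, ensures_tick, ensures_pure, ensures_read, ih, add_assoc]

theorem ensures_latestIdle {S : Finset (Fin n)} {C u : ℕ} {Q : Option ℕ → Table n → Prop}
    (h₀ : (∀ s ∈ Finset.Icc 1 u, C ≤ used S y s) → Q none y)
    (h₁ : ∀ t ∈ Finset.Icc 1 u, used S y t < C →
      (∀ s, t < s → s ≤ u → C ≤ used S y s) → Q (some t) y) :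
    Ensures (latestIdle S C u) y Q := by
  induction u with
  | zero =>
    simp only [latestIdle, ensures_bind, ensures_tick, ensures_pure]
    exact h₀ (by simp)
  | succ u ih =>
    simp only [latestIdle, ensures_bind, ensures_tick, ensures_avail]
    split_ifs with h
    · rw [ensures_pure]
      exact h₁ _ (by simp) (by omega) fun s _ _ => by omega
    · refine ih (fun H => h₀ fun s hs => ?_) fun t ht hC H => h₁ t ?_ hC fun s hs hsu => ?_
      · rw [Finset.mem_Icc] at hs
        rcases hs.2.lt_or_eq with hlt | rfl
        · exact H s (Finset.mem_Icc.2 ⟨hs.1, by omega⟩)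
        · omega
      · rw [Finset.mem_Icc] at ht ⊢
        omega
      · rcases hsu.lt_or_eq with hlt | rfl
        · exact H s hs (by omega)
        · omega

theorem ensures_findTask {t t' : ℕ} {l : List (Fin n)} {Q : Option (Fin n) → Table n → Prop}
    (h₀ : (∀ j ∈ l, y j t ≤ y j t') → Q none y)
    (h₁ : ∀ j ∈ l, y j t' < y j t → Q (some j) y) :
    Ensures (findTask t t' l) y Q := by
  induction l with
  | nil =>
    simp only [findTask, ensures_bind, ensures_tick, ensures_pure]
    exact h₀ (by simp)
  | cons j l ih =>
    simp only [findTask, ensures_bind, ensures_tick, ensures_read]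
    split_ifs with h
    · rw [ensures_pure]
      exact h₁ j (by simp) h
    · refine ih (fun H => h₀ ?_) fun i hi => h₁ i (by simp [hi])
      simpa using ⟨by omega, H⟩

theorem ensures_withDeadline {T : Fin n → Task} {d : ℕ} {l : List (Fin n)}
    {Q : List (Fin n) → Table n → Prop} :
    Ensures (withDeadline T d l) y Q ↔ Q (l.filter fun i => (T i).deadline = d) y := by
  induction l generalizing Q with
  | nil => simp [withDeadline, ensures_bind, ensures_tick, ensures_pure]
  | cons i l ih =>
    simp only [withDeadline, ensures_bind, ensures_tick, ih, List.filter_cons, decide_eq_true_eq]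
    split_ifs <;> rw [ensures_pure]

theorem ensures_clearSlots {i : Fin n} {t : ℕ} {Q : Unit → Table n → Prop} :
    Ensures (clearSlots i t) y Q ↔
      Q () (Function.update y i fun v => if v ∈ Finset.Icc 1 t then 0 else y i v) := by
  induction t generalizing y Q with
  | zero => simp [clearSlots, ensures_tick]
  | succ t ih =>
    simp only [clearSlots, ensures_bind, ensures_tick, ensures_write, ih]
    congr! 1
    ext j v
    by_cases hj : j = i
    · subst hj
      simp only [Function.update_self, Function.update_apply, Finset.mem_Icc]
      split_ifs <;> first | rfl | omega
    · simp [hj]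

theorem ensures_findSlot {i : Fin n} {θ r u acc : ℕ} {Q : ℕ × ℕ → Table n → Prop}
    (hacc : acc < θ) (hr : θ ≤ acc + ∑ v ∈ Finset.Ico u (u + r), y i v)
    (h : ∀ u', u ≤ u' → acc + ∑ v ∈ Finset.Ico u u', y i v < θ →
      θ ≤ acc + ∑ v ∈ Finset.Ico u u', y i v + y i u' →
      Q (u', acc + ∑ v ∈ Finset.Ico u u', y i v) y) :
    Ensures (findSlot i θ r u acc) y Q := by
  induction r generalizing u acc with
  | zero => simp at hr; omega
  | succ r ih =>
    simp only [findSlot, ensures_bind, ensures_tick, ensures_read]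
    split_ifs with hθ
    · rw [ensures_pure]
      simpa using h u le_rfl (by simpa using hacc) (by simpa using hθ)
    · have hsum : ∀ u', u + 1 ≤ u' → acc + y i u + ∑ v ∈ Finset.Ico (u + 1) u', y i v =
          acc + ∑ v ∈ Finset.Ico u u', y i v := fun u' hu => by
        rw [Finset.sum_eq_sum_Ico_succ_bot (a := u) (by omega), add_assoc]
      refine ih (by omega) ?_ fun u' hu h₁ h₂ => ?_
      · rw [hsum _ (by omega)]
        convert hr using 4
        omega
      · rw [hsum _ hu] at h₁ h₂ ⊢
        exact h u' (by omega) h₁ h₂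

end Ensures

/-! ### Running time -/

section Runs

variable {n : ℕ} {α β : Type} {c : ℕ}

theorem Runs.mono {p : Prog n α} {a b : ℕ} {P Q : α → Prop} (h : Runs p a P) (hab : a ≤ b)
    (hPQ : ∀ v, P v → Q v) : Runs p b Q :=
  fun y => ⟨(h y).1, fun r hr => ⟨((h y).2 r hr).1.trans hab, hPQ _ ((h y).2 r hr).2⟩⟩

theorem runs_pure {a : α} {Q : α → Prop} (h : Q a) : Runs (pure a : Prog n α) c Q :=
  fun _ => ⟨⟨_, rfl⟩, by rintro r rfl; exact ⟨Nat.zero_le _, h⟩⟩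

/-- The bound `c` acts as a budget from which the time of the first program is deducted. -/
theorem Runs.bind {p : Prog n α} {f : α → Prog n β} {a : ℕ} {P : α → Prop} {Q : β → Prop}
    (hp : Runs p a P) (ha : a ≤ c) (hf : ∀ v, P v → Runs (f v) (c - a) Q) :
    Runs (p >>= f) c Q := by
  intro y
  constructor
  · obtain ⟨r, hr⟩ := (hp y).1
    obtain ⟨r', hr'⟩ := (hf _ ((hp y).2 r hr).2 r.table).1
    exact ⟨_, r, hr, r', hr', rfl⟩
  · rintro _ ⟨r, hr, r', hr', rfl⟩
    have h₁ := (hp y).2 r hr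
    have h₂ := (hf _ h₁.2 r.table).2 r' hr'
    exact ⟨by have := h₁.1; have := h₂.1; dsimp only; omega, h₂.2⟩

theorem runs_tick {a : ℕ} : Runs (tick a : Prog n Unit) a fun _ => True :=
  fun _ => ⟨⟨_, rfl⟩, by rintro r rfl; exact ⟨le_rfl, trivial⟩⟩

theorem runs_read {i : Fin n} {t : ℕ} : Runs (read i t) 1 fun _ => True :=
  fun _ => ⟨⟨_, rfl⟩, by rintro r rfl; exact ⟨le_rfl, trivial⟩⟩

theorem runs_write {i : Fin n} {t v : ℕ} : Runs (write i t v) 1 fun _ => True :=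
  fun _ => ⟨⟨_, rfl⟩, by rintro r rfl; exact ⟨le_rfl, trivial⟩⟩

theorem runs_listing {A : Finset (Fin n)} :
    Runs (listing A) 0 fun l => l.Nodup ∧ l.toFinset = A ∧ l.length = A.card := by
  refine fun y => ⟨⟨⟨A.toList, y, 0⟩, A.nodup_toList, A.toList_toFinset, rfl, rfl⟩, ?_⟩
  rintro r ⟨h₁, h₂, -, h₄⟩
  exact ⟨h₄.le, h₁, h₂, by rw [← h₂, List.toFinset_card_of_nodup h₁]⟩

theorem runs_sumTasks {t : ℕ} {l : List (Fin n)} :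
    Runs (sumTasks t l) (3 * l.length + 1) fun _ => True := by
  induction l with
  | nil => exact runs_tick.bind (by simp) fun _ _ => runs_pure trivial
  | cons i l ih =>
    rw [List.length_cons]
    exact runs_tick.bind (by omega) fun _ _ => runs_read.bind (by omega) fun _ _ =>
      ih.bind (by omega) fun _ _ => runs_pure trivial

theorem runs_avail {S : Finset (Fin n)} {C t : ℕ} :
    Runs (avail S C t) (3 * S.card + 2) fun _ => True :=
  runs_listing.bind (by omega) fun l hl => runs_sumTasks.bind (by omega) fun _ _ =>
    runs_tick.bind (by omega) fun _ _ => runs_pure trivial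

theorem runs_sumSlots {i : Fin n} {a r : ℕ} :
    Runs (sumSlots i a r) (3 * r + 1) fun _ => True := by
  induction r with
  | zero => exact runs_tick.bind (by simp) fun _ _ => runs_pure trivial
  | succ r ih =>
    exact runs_tick.bind (by omega) fun _ _ => ih.bind (by omega) fun _ _ =>
      runs_read.bind (by omega) fun _ _ => runs_pure trivial

theorem runs_latestIdle {S : Finset (Fin n)} {C u : ℕ} :
    Runs (latestIdle S C u) (u * (3 * S.card + 4) + 1) fun o => ∀ t ∈ o, t ≤ u := by
  induction u with
  | zero => exact runs_tick.bind (by simp) fun _ _ => runs_pure (by simp)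
  | succ u ih =>
    rw [Nat.succ_mul]
    refine runs_tick.bind (by omega) fun _ _ => runs_avail.bind (by omega) fun w _ => ?_
    split_ifs
    · exact runs_pure (by simp)
    · exact ih.mono (by omega) fun o ho t ht => (ho t ht).trans (by omega)

theorem runs_findTask {t t' : ℕ} {l : List (Fin n)} :
    Runs (findTask t t' l) (4 * l.length + 1) fun _ => True := by
  induction l with
  | nil => exact runs_tick.bind (by simp) fun _ _ => runs_pure trivial
  | cons i l ih =>
    rw [List.length_cons]
    refine runs_tick.bind (by omega) fun _ _ => runs_read.bind (by omega) fun _ _ =>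
      runs_read.bind (by omega) fun _ _ => ?_
    split_ifs
    · exact runs_pure trivial
    · exact ih.mono (by omega) fun _ h => h

theorem runs_withDeadline {T : Fin n → Task} {d : ℕ} {l : List (Fin n)} :
    Runs (withDeadline T d l) (3 * l.length + 1) fun b => b.length ≤ l.length := by
  induction l with
  | nil => exact runs_tick.bind (by simp) fun _ _ => runs_pure (by simp)
  | cons i l ih =>
    rw [List.length_cons]
    refine runs_tick.bind (by omega) fun _ _ => ih.bind (by omega) fun b hb => ?_
    split_ifs
    · exact runs_pure (by simpa using hb)
    · exact runs_pure (by omega)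

theorem runs_findSlot {i : Fin n} {θ r u acc : ℕ} :
    Runs (findSlot i θ r u acc) (4 * r + 1) fun p => p.1 ≤ u + r := by
  induction r generalizing u acc with
  | zero => exact runs_tick.bind (by simp) fun _ _ => runs_pure (by simp)
  | succ r ih =>
    refine runs_tick.bind (by omega) fun _ _ => runs_read.bind (by omega) fun v _ => ?_
    split_ifs
    · exact runs_pure (by simp)
    · exact ih.mono (by omega) fun p hp => by omega

theorem runs_clearSlots {i : Fin n} {t : ℕ} :
    Runs (clearSlots i t) (2 * t + 1) fun _ => True := by
  induction t with
  | zero => exact runs_tick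
  | succ t ih =>
    exact runs_tick.bind (by omega) fun _ _ => runs_write.bind (by omega) fun _ _ =>
      ih.mono (by omega) fun _ h => h

theorem runs_removeEarliest {T : Fin n → Task} {i : Fin n} {θ : ℕ} :
    Runs (removeEarliest T i θ) (6 * (T i).deadline + 8) fun _ => True := by
  refine runs_tick.bind (by omega) fun _ _ => ?_
  split_ifs
  · exact runs_findSlot.bind (by omega) fun p hp => runs_read.bind (by omega) fun _ _ =>
      runs_tick.bind (by omega) fun _ _ => runs_write.bind (by omega) fun _ _ =>
      runs_clearSlots.mono (by omega) fun _ h => h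
  · exact runs_pure trivial

/-- A bound for the time of one pass of the loop of `routine`, for `s` tasks and slots up to `d`. -/
def passTime (s d : ℕ) : ℕ := d * (3 * s + 4) + 7 * s + 3 * d + 20

theorem runs_routineLoop {S : Finset (Fin n)} {C : ℕ} {i : Fin n} {t Δ fuel d : ℕ} {b : Bool}
    (ht : t ≤ d) :
    Runs (routineLoop S C i t Δ b fuel) (fuel * passTime S.card d) fun _ => True := by
  induction fuel with
  | zero => exact runs_pure trivial
  | succ fuel ih =>
    have hd : (t - 1) * (3 * S.card + 4) ≤ d * (3 * S.card + 4) :=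
      Nat.mul_le_mul_right _ (by omega)
    rw [Nat.succ_mul]
    have hpass : passTime S.card d = d * (3 * S.card + 4) + 7 * S.card + 3 * d + 20 := rfl
    refine runs_tick.bind (by omega) fun _ _ => runs_avail.bind (by omega) fun w _ => ?_
    split_ifs
    · refine runs_latestIdle.bind (by omega) fun o ho => ?_
      rcases o with _ | t'
      · exact runs_pure trivial
      have ht' : t' ≤ t - 1 := ho t' rfl
      refine runs_sumSlots.bind (by omega) fun _ _ => runs_tick.bind (by omega) fun _ _ => ?_
      split_ifs
      · exact runs_pure trivial
      refine runs_listing.bind (by omega) fun l hl => runs_findTask.bind (by omega) fun o _ => ?_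
      rcases o with _ | j
      · exact runs_pure trivial
      exact runs_tick.bind (by omega) fun _ _ => runs_read.bind (by omega) fun _ _ =>
        runs_write.bind (by omega) fun _ _ => runs_read.bind (by omega) fun _ _ =>
        runs_write.bind (by omega) fun _ _ => ih.mono (by omega) fun _ h => h
    · exact runs_pure trivial

theorem runs_routine {S : Finset (Fin n)} {C : ℕ} {i : Fin n} {t Δ d k : ℕ} {b : Bool}
    (ht : t ≤ d) (hk : Δ ≤ k) :
    Runs (routine S C i t Δ b) ((k + 1) * passTime S.card d) fun _ => True :=
  (runs_routineLoop ht).mono (Nat.mul_le_mul_right _ (by omega)) fun _ h => h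

theorem runs_fullyUtilize {T : Fin n → Task} {S : Finset (Fin n)} {C : ℕ} {i : Fin n} {t : ℕ} :
    Runs (fullyUtilize T S C i t) (t * (3 * S.card + 3 * (T i).deadline + 8) + 1)
      fun _ => True := by
  induction t with
  | zero => exact runs_tick.mono (by omega) fun _ h => h
  | succ t ih =>
    rw [Nat.succ_mul]
    exact runs_sumSlots.bind (by omega) fun _ _ => runs_avail.bind (by omega) fun _ _ =>
      runs_tick.bind (by omega) fun _ _ => runs_write.bind (by omega) fun _ _ =>
      ih.mono (by omega) fun _ h => h

theorem runs_fullyAllocateLoop {T : Fin n → Task} {S : Finset (Fin n)} {C : ℕ} {i : Fin n}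
    {t Ω d : ℕ} (ht : t ≤ d) :
    Runs (fullyAllocateLoop T S C i t Ω)
      (t * (((T i).bound + 1) * passTime S.card d + 3 * S.card + 12) + 1) fun _ => True := by
  induction t generalizing Ω with
  | zero => exact runs_tick.mono (by omega) fun _ h => h
  | succ t ih =>
    rw [Nat.succ_mul]
    refine runs_tick.bind (by omega) fun _ _ => ?_
    split_ifs
    · refine runs_read.bind (by omega) fun v _ => runs_tick.bind (by omega) fun _ _ => ?_
      split_ifs
      · exact (runs_routine ht (k := (T i).bound) (by omega)).bind (by omega) fun _ _ =>
          runs_avail.bind (by omega) fun _ _ => runs_read.bind (by omega) fun _ _ =>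
          runs_tick.bind (by omega) fun _ _ => runs_write.bind (by omega) fun _ _ =>
          (ih (by omega)).mono (by omega) fun _ h => h
      · exact (ih (by omega)).mono (by omega) fun _ h => h
    · exact runs_pure trivial

theorem runs_allocateRLM {T : Fin n → Task} {S : Finset (Fin n)} {C : ℕ} {i : Fin n} {t : ℕ}
    (ht : t ≤ (T i).deadline) :
    Runs (allocateRLM T S C i t)
      (t * (((T i).bound + 1) * passTime S.card (T i).deadline + 3 * S.card +
        9 * (T i).deadline + 20) + 1) fun _ => True := by
  induction t with
  | zero => exact runs_tick.mono (by omega) fun _ h => h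
  | succ t ih =>
    rw [Nat.succ_mul]
    refine runs_sumSlots.bind (by omega) fun s _ => runs_tick.bind (by omega) fun _ _ => ?_
    split_ifs
    · refine runs_read.bind (by omega) fun v _ => runs_tick.bind (by omega) fun _ _ => ?_
      split_ifs
      · exact (runs_routine ht (k := (T i).bound) (by omega)).bind (by omega) fun _ _ =>
          runs_avail.bind (by omega) fun _ _ => runs_read.bind (by omega) fun _ _ =>
          runs_tick.bind (by omega) fun _ _ => runs_write.bind (by omega) fun _ _ =>
          runs_removeEarliest.bind (by omega) fun _ _ =>
          (ih (by omega)).mono (by omega) fun _ h => h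
      · exact (ih (by omega)).mono (by omega) fun _ h => h
    · exact runs_pure trivial

/-- A bound for the time of `allocateB`, for `s` tasks, deadline `d` and parallelism bound `k`. -/
def taskTime (s d k : ℕ) : ℕ :=
  d * (3 * s + 3 * d + 8) + d * ((k + 1) * passTime s d + 3 * s + 12) +
    d * ((k + 1) * passTime s d + 3 * s + 9 * d + 20) + 3 * d + 5

theorem runs_allocateB {T : Fin n → Task} {S : Finset (Fin n)} {C : ℕ} {i : Fin n} :
    Runs (allocateB T S C i) (taskTime S.card (T i).deadline (T i).bound) fun _ => True := by
  unfold taskTime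
  refine runs_fullyUtilize.bind (by omega) fun _ _ =>
    Runs.bind (a := 3 * (T i).deadline + 2 + ((T i).deadline *
      (((T i).bound + 1) * passTime S.card (T i).deadline + 3 * S.card + 12) + 1))
      (P := fun _ => True) ?_ (by omega)
      fun _ _ => (runs_allocateRLM le_rfl).mono (by omega) fun _ h => h
  exact runs_sumSlots.bind (by omega) fun _ _ => runs_tick.bind (by omega) fun _ _ =>
    (runs_fullyAllocateLoop le_rfl).mono (by omega) fun _ h => h

theorem passTime_mono {s d d' : ℕ} (hd : d ≤ d') : passTime s d ≤ passTime s d' := by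
  unfold passTime
  gcongr

theorem taskTime_mono {s d d' k k' : ℕ} (hd : d ≤ d') (hk : k ≤ k') :
    taskTime s d k ≤ taskTime s d' k' := by
  have := passTime_mono (s := s) hd
  unfold taskTime
  gcongr

theorem taskTime_le {s d k : ℕ} (hs : 0 < s) : taskTime s d k ≤ taskTime 1 d k * s := by
  have hp : passTime s d ≤ passTime 1 d * s := by
    unfold passTime
    nlinarith [Nat.zero_le d, Nat.mul_le_mul_left d hs]
  have h₁ : (k + 1) * passTime s d ≤ (k + 1) * passTime 1 d * s := by
    rw [mul_assoc]
    exact Nat.mul_le_mul_left _ hp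
  calc taskTime s d k
      ≤ d * (3 * s + 3 * d + 8) + d * ((k + 1) * passTime 1 d * s + 3 * s + 12) +
        d * ((k + 1) * passTime 1 d * s + 3 * s + 9 * d + 20) + 3 * d + 5 := by
        unfold taskTime
        gcongr
    _ ≤ taskTime 1 d k * s := by
        unfold taskTime
        generalize (k + 1) * passTime 1 d = p
        nlinarith [Nat.mul_le_mul_left d hs, Nat.mul_le_mul_left (d * d) hs]

theorem runs_allocateAll {T : Fin n → Task} {S : Finset (Fin n)} {C c : ℕ}
    (hc : ∀ i, taskTime S.card (T i).deadline (T i).bound ≤ c) {l : List (Fin n)} :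
    Runs (allocateAll T S C l) (l.length * (c + 2) + 1) fun _ => True := by
  induction l with
  | nil => exact runs_tick.mono (by simp) fun _ h => h
  | cons i l ih =>
    have := hc i
    rw [List.length_cons, Nat.succ_mul]
    exact runs_tick.bind (by omega) fun _ _ => runs_allocateB.bind (by omega) fun _ _ =>
      ih.mono (by omega) fun _ h => h

theorem runs_ldfLoop {T : Fin n → Task} {S : Finset (Fin n)} {C c : ℕ}
    (hc : ∀ i, taskTime S.card (T i).deadline (T i).bound ≤ c) {m : ℕ} :
    Runs (ldfLoop T S C m) (m * (S.card * (c + 5) + 4) + 1) fun _ => True := by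
  induction m with
  | zero => exact runs_tick.mono (by simp) fun _ h => h
  | succ m ih =>
    have h₁ : S.card * (c + 5) = S.card * (c + 2) + 3 * S.card := by ring
    rw [Nat.succ_mul]
    refine runs_tick.bind (by omega) fun _ _ => runs_listing.bind (by omega) fun l hl =>
      runs_withDeadline.bind (by omega) fun b hb => ?_
    have h₂ : b.length * (c + 2) ≤ S.card * (c + 2) := Nat.mul_le_mul_right _ (by omega)
    exact (runs_allocateAll hc).bind (by omega) fun _ _ => ih.mono (by omega) fun _ h => h

/-- LDF has a run: take the largest time of `allocateB` as a bound in `runs_ldfLoop`. -/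
theorem ldfRuns_nonempty (T : Fin n → Task) (S : Finset (Fin n)) (C : ℕ) :
    (ldfRuns T S C).Nonempty :=
  (runs_ldfLoop (c := Finset.univ.sup fun i => taskTime S.card (T i).deadline (T i).bound)
    (fun i => Finset.le_sup (f := fun i => taskTime S.card (T i).deadline (T i).bound)
      (Finset.mem_univ i)) _).1

theorem numDeadlines_le {T : Fin n → Task} {d : ℕ} (hd : ∀ i, (T i).deadline ≤ d) :
    numDeadlines T ≤ d := by
  have : deadlines T ⊆ Finset.Icc 1 d := by
    intro x hx
    obtain ⟨i, -, rfl⟩ := Finset.mem_image.1 hx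
    exact Finset.mem_Icc.2 ⟨(T i).deadline_pos, hd i⟩
  simpa [numDeadlines] using Finset.card_le_card this

theorem time_le {T : Fin n → Task} {S : Finset (Fin n)} {C d k : ℕ}
    (hd : ∀ i, (T i).deadline ≤ d) (hk : ∀ i, (T i).bound ≤ k) (hS : S.Nonempty)
    {r : Outcome n Unit} (hr : r ∈ ldfRuns T S C) :
    r.time ≤ (d * (taskTime 1 d k + 9) + 1) * S.card ^ 2 := by
  have hs : 0 < S.card := hS.card_pos
  have h₁ := ((runs_ldfLoop (C := C) (m := numDeadlines T) fun i =>
    (taskTime_mono (hd i) (hk i)).trans (taskTime_le hs)) _).2 r hr |>.1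
  refine h₁.trans ?_
  have h₂ : S.card * (taskTime 1 d k * S.card + 5) + 4 ≤
      (taskTime 1 d k + 9) * S.card ^ 2 := by
    nlinarith
  have h₃ : 1 ≤ S.card ^ 2 := Nat.one_le_pow _ _ hs
  calc _ ≤ d * ((taskTime 1 d k + 9) * S.card ^ 2) + S.card ^ 2 :=
        Nat.add_le_add (Nat.mul_le_mul (numDeadlines_le hd) h₂) h₃
    _ = _ := by ring

end Runs

/-! ### The boundary condition as a bound on forced work -/

/-- The work that cannot be done after slot `u`, however many machines there are. Task `j` can do
at most `k_j (d_j - u)` units there; both differences are truncated at `0`. -/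
def forced {n : ℕ} (T : Fin n → Task) (S : Finset (Fin n)) (u : ℕ) : ℕ :=
  ∑ j ∈ S, ((T j).workload - (T j).bound * ((T j).deadline - u))

section Boundary

variable {n : ℕ} {T : Fin n → Task} {S : Finset (Fin n)} {C : ℕ}

theorem tau_zero : tau T 0 = 0 := rfl

theorem pairwise_zero_cons_sort :
    (0 :: (deadlines T).sort (· ≤ ·)).Pairwise (· < ·) := by
  refine List.pairwise_cons.2 ⟨fun x hx => ?_, (deadlines T).sortedLT_sort.pairwise⟩
  obtain ⟨i, -, rfl⟩ := Finset.mem_image.1 ((Finset.mem_sort _).1 hx)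
  exact (T i).deadline_pos

theorem tau_lt_tau {p q : ℕ} (hpq : p < q) (hq : q ≤ numDeadlines T) : tau T p < tau T q := by
  have hlen : (0 :: (deadlines T).sort (· ≤ ·)).length = numDeadlines T + 1 := by
    simp [numDeadlines]
  unfold tau
  rw [List.getD_eq_getElem _ _ (by omega), List.getD_eq_getElem _ _ (by omega)]
  exact List.pairwise_iff_getElem.1 pairwise_zero_cons_sort _ _ _ _ hpq

theorem tau_le_tau {p q : ℕ} (hpq : p ≤ q) (hq : q ≤ numDeadlines T) : tau T p ≤ tau T q := by
  rcases hpq.eq_or_lt with rfl | h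
  · rfl
  · exact (tau_lt_tau h hq).le

theorem exists_tau_eq_deadline (i : Fin n) :
    ∃ p, 1 ≤ p ∧ p ≤ numDeadlines T ∧ tau T p = (T i).deadline := by
  have hmem : (T i).deadline ∈ (deadlines T).sort (· ≤ ·) :=
    (Finset.mem_sort _).2 (Finset.mem_image_of_mem _ (Finset.mem_univ i))
  obtain ⟨p, hp, h⟩ := List.getElem_of_mem hmem
  rw [Finset.length_sort] at hp
  refine ⟨p + 1, by omega, hp, ?_⟩
  rw [tau, List.getD_cons_succ, List.getD_eq_getElem _ _ (by simpa using hp), h]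

theorem deadline_le_tau (i : Fin n) : (T i).deadline ≤ tau T (numDeadlines T) := by
  obtain ⟨p, -, hp, h⟩ := exists_tau_eq_deadline (T := T) i
  exact h ▸ tau_le_tau hp le_rfl

/-- There is no deadline strictly between `τ_m` and `τ_{m+1}`. -/
theorem deadline_le_or_ge {m : ℕ} (hm : m < numDeadlines T) (i : Fin n) :
    (T i).deadline ≤ tau T m ∨ tau T (m + 1) ≤ (T i).deadline := by
  obtain ⟨p, -, hp, h⟩ := exists_tau_eq_deadline (T := T) i
  rw [← h]
  rcases le_or_gt p m with hpm | hpm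
  · exact .inl (tau_le_tau hpm hm.le)
  · exact .inr (tau_le_tau hpm hp)

theorem lam_eq (m : ℕ) : lam T S m =
    ∑ j ∈ S, min (T j).workload
      ((T j).bound * ((T j).deadline - tau T (numDeadlines T - m))) := by
  refine Finset.sum_congr rfl fun j _ => ?_
  have h : (T j).len ≤ (T j).deadline - tau T (numDeadlines T - m) ↔ _ :=
    ceilDiv_le_iff_le_mul (T j).bound_pos
  split_ifs with hl
  · exact (min_eq_left (h.1 hl)).symm
  · rw [h, not_le] at hl
    exact (min_eq_right hl.le).symm

theorem forced_add_lam (m : ℕ) :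
    forced T S (tau T (numDeadlines T - m)) + lam T S m = ∑ j ∈ S, (T j).workload := by
  rw [lam_eq, forced, ← Finset.sum_add_distrib]
  exact Finset.sum_congr rfl fun j _ => by omega

theorem lam_mono {m m' : ℕ} (h : m ≤ m') : lam T S m ≤ lam T S m' := by
  rw [lam_eq, lam_eq]
  have : tau T (numDeadlines T - m') ≤ tau T (numDeadlines T - m) :=
    tau_le_tau (by omega) (by omega)
  gcongr

theorem lamC_le_lam (m : ℕ) : lamC T S C m ≤ lam T S m := by
  induction m with
  | zero => exact Nat.zero_le _
  | succ m ih =>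
    have := lam_mono (T := T) (S := S) (Nat.le_add_right m 1)
    rw [lamC]
    omega

theorem forced_of_tau_le {u : ℕ} (hu : tau T (numDeadlines T) ≤ u) :
    forced T S u = ∑ j ∈ S, (T j).workload := by
  refine Finset.sum_congr rfl fun j _ => ?_
  have := deadline_le_tau (T := T) j
  have h₁ : (T j).deadline - u = 0 := by omega
  rw [h₁, mul_zero, Nat.sub_zero]

theorem boundary_of_forced_le (h : ∀ u, forced T S u ≤ C * u) : Boundary T S C := by
  have key : ∀ p ≤ numDeadlines T,
      ∑ j ∈ S, (T j).workload ≤ lamC T S C p + C * tau T (numDeadlines T - p) := by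
    intro p
    induction p with
    | zero =>
      intro _
      rw [← forced_of_tau_le (T := T) (S := S) le_rfl]
      simpa [lamC] using h _
    | succ p ih =>
      intro hp
      have h₁ := forced_add_lam (T := T) (S := S) (p + 1)
      have h₂ := h (tau T (numDeadlines T - (p + 1)))
      have h₃ := ih (by omega)
      have h₄ : C * (tau T (numDeadlines T - p) - tau T (numDeadlines T - (p + 1))) +
          C * tau T (numDeadlines T - (p + 1)) = C * tau T (numDeadlines T - p) := by
        rw [← mul_add, Nat.sub_add_cancel (tau_le_tau (by omega) (by omega))]
      rw [lamC]
      omega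
  intro m hm
  have := key (numDeadlines T - m) (by omega)
  rw [Nat.sub_sub_self hm] at this
  rw [mu]
  omega

theorem exists_tau_le_lt {u : ℕ} (hu : u < tau T (numDeadlines T)) :
    ∃ m < numDeadlines T, tau T m ≤ u ∧ u < tau T (m + 1) := by
  have key : ∀ p ≤ numDeadlines T, u < tau T p →
      ∃ m < numDeadlines T, tau T m ≤ u ∧ u < tau T (m + 1) := by
    intro p
    induction p with
    | zero => intro _ h; simp [tau_zero] at h
    | succ p ih =>
      intro hp h
      rcases le_or_gt (tau T p) u with h' | h'
      · exact ⟨p, by omega, h', h⟩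
      · exact ih (by omega) h'
  exact key _ le_rfl hu

/-- `u ↦ max 0 (D - k (d - u))` is convex for `u ≤ d`. Here `e + z` is
the value of `d - u` at a point of an interval, and `e + z + x` and `e` are those at the ends. -/
theorem forced_convex_aux (D k x z e : ℕ) :
    (x + z) * (D - k * (e + z)) ≤ z * (D - k * (e + z + x)) + x * (D - k * e) := by
  rcases le_total D (k * (e + z)) with h | h
  · simp [Nat.sub_eq_zero_of_le h]
  · zify [h, (Nat.mul_le_mul_left k (Nat.le_add_right e z)).trans h]
    have h₁ : (D : ℤ) - k * (e + z + x) ≤ ((D - k * (e + z + x) : ℕ) : ℤ) := by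
      have := Int.le_natCast_sub D (k * (e + z + x))
      push_cast at this
      exact this
    nlinarith [mul_le_mul_of_nonneg_left h₁ (Int.natCast_nonneg z)]

/-- The converse of `boundary_of_forced_le`. Between two consecutive deadlines the forced work is a
convex function of `u`, so that the bounds at the points `τ_m` imply the others. -/
theorem forced_le_of_boundary (h : Boundary T S C) (u : ℕ) : forced T S u ≤ C * u := by
  have htau : ∀ m ≤ numDeadlines T, forced T S (tau T m) ≤ C * tau T m := by
    intro m hm
    have h₁ := h m hm
    have h₂ := lamC_le_lam (T := T) (S := S) (C := C) (numDeadlines T - m)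
    have h₃ := forced_add_lam (T := T) (S := S) (numDeadlines T - m)
    rw [Nat.sub_sub_self hm] at h₃
    rw [mu] at h₁
    omega
  rcases le_or_gt (tau T (numDeadlines T)) u with hu | hu
  · rw [forced_of_tau_le hu, ← forced_of_tau_le (T := T) le_rfl]
    exact (htau _ le_rfl).trans (Nat.mul_le_mul_left _ hu)
  obtain ⟨m, hm, hmu, hum⟩ := exists_tau_le_lt hu
  obtain ⟨x, rfl⟩ := Nat.exists_eq_add_of_le hmu
  obtain ⟨z, hz⟩ := Nat.exists_eq_add_of_le hum.le
  have hconv : (x + z) * forced T S (tau T m + x) ≤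
      z * forced T S (tau T m) + x * forced T S (tau T (m + 1)) := by
    simp only [forced, Finset.mul_sum, ← Finset.sum_add_distrib]
    refine Finset.sum_le_sum fun j _ => ?_
    rcases deadline_le_or_ge hm j with hj | hj
    · have h₁ : (T j).deadline - (tau T m + x) = 0 := by omega
      have h₂ : (T j).deadline - tau T m = 0 := by omega
      have h₃ : (T j).deadline - tau T (m + 1) = 0 := by omega
      rw [h₁, h₂, h₃]
      simp only [mul_zero, Nat.sub_zero]
      linarith
    · obtain ⟨e, he⟩ := Nat.exists_eq_add_of_le hj
      have h₁ : (T j).deadline - (tau T m + x) = e + z := by omega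
      have h₂ : (T j).deadline - tau T m = e + z + x := by omega
      have h₃ : (T j).deadline - tau T (m + 1) = e := by omega
      rw [h₁, h₂, h₃]
      exact forced_convex_aux _ _ _ _ _
  have h₁ := Nat.mul_le_mul_left z (htau m hm.le)
  have h₂ := Nat.mul_le_mul_left x (htau (m + 1) hm)
  refine le_of_mul_le_mul_left (a := x + z) ?_ (by omega)
  calc _ ≤ z * (C * tau T m) + x * (C * tau T (m + 1)) := by omega
    _ = _ := by rw [hz]; ring

theorem before_eq_add {y : Table n} {j : Fin n} {d : ℕ} (u : ℕ) (h : ∀ v, d < v → y j v = 0) :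
    before y j (d + 1) = before y j (u + 1) + ∑ v ∈ Finset.Ico (u + 1) (d + 1), y j v := by
  rcases le_total u d with hu | hu
  · exact (Finset.sum_Ico_consecutive _ (by omega) (by omega)).symm
  · rw [Finset.Ico_eq_empty_of_le (by omega : d + 1 ≤ u + 1), Finset.sum_empty, add_zero]
    refine Finset.sum_subset (Finset.Ico_subset_Ico_right (by omega)) fun v hv hv' => h v ?_
    rw [Finset.mem_Ico] at hv hv'
    omega

/-- A task does at most `k_j (d_j - u)` units after slot `u`. -/
theorem Feasible.forced_le {y : Table n} (hy : Feasible T S C y) (u : ℕ) :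
    forced T S u ≤ C * u := by
  have h₁ : forced T S u ≤ ∑ j ∈ S, before y j (u + 1) := by
    refine Finset.sum_le_sum fun j hj => ?_
    have h₂ := hy.completed j hj
    have h₃ : ∑ v ∈ Finset.Ico (u + 1) ((T j).deadline + 1), y j v ≤
        (T j).bound * ((T j).deadline - u) := by
      refine (Finset.sum_le_card_nsmul _ _ _ fun v _ => hy.parallelism j hj v).trans ?_
      simp [mul_comm]
    rw [← Finset.Ico_add_one_right_eq_Icc] at h₂
    have h₄ := before_eq_add u fun v hv => hy.window j hj v fun h =>
      absurd (Finset.mem_Icc.1 h).2 hv.not_ge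
    rw [before] at h₄
    omega
  refine h₁.trans ?_
  unfold before
  rw [Finset.sum_comm]
  refine (Finset.sum_le_card_nsmul _ _ C fun t _ => hy.capacity t).trans ?_
  simp [mul_comm]

end Boundary

/-! ### Packed schedules -/

section Packed

variable {n : ℕ} {T : Fin n → Task} {S : Finset (Fin n)} {C : ℕ} {y z : Table n} {i j : Fin n}

/-- Task `j` is packed towards its deadline: from every slot `s` with an idle machine on it runs at
full parallelism, unless all its work lies in `s` or later. -/
def Packed (T : Fin n → Task) (S : Finset (Fin n)) (C : ℕ) (y : Table n) (j : Fin n) : Prop :=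
  ∀ s, used S y s < C →
    (∀ v, s ≤ v → v ≤ (T j).deadline → y j v = (T j).bound) ∨ ∀ v < s, y j v = 0

/-- The conditions of a feasible schedule apart from completion. -/
structure Valid (T : Fin n → Task) (S : Finset (Fin n)) (C : ℕ) (y : Table n) : Prop where
  window : ∀ j ∈ S, ∀ t, t ∉ Finset.Icc 1 (T j).deadline → y j t = 0
  parallelism : ∀ j ∈ S, ∀ t, y j t ≤ (T j).bound
  capacity : ∀ t, used S y t ≤ C

/-- The invariant between two calls of `allocateB`: the tasks in `A` are completed and packed, the
others are not started, and up to slot `d` the load does not decrease. -/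
structure Good (T : Fin n → Task) (S : Finset (Fin n)) (C : ℕ) (A : Finset (Fin n)) (d : ℕ)
    (y : Table n) : Prop extends Valid T S C y where
  completed : ∀ j ∈ S, j ∈ A → before y j ((T j).deadline + 1) = (T j).workload
  unstarted : ∀ j ∈ S, j ∉ A → ∀ v, y j v = 0
  packed : ∀ j ∈ S, Packed T S C y j
  mono : ∀ v s, v ≤ s → s ≤ d → used S y v ≤ used S y s

/-- The invariant while `allocateB` treats task `i`. Nothing is said about the amount and the
packing of `i`. The last field says that, up to the deadline of `i`, even the load of the other
tasks does not decrease as long as slots with an idle machine are compared with earlier ones; it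
keeps the total load monotone when work of `i` is removed from the earliest slots. -/
structure InProgress (T : Fin n → Task) (S : Finset (Fin n)) (C : ℕ) (A : Finset (Fin n))
    (i : Fin n) (y : Table n) : Prop extends Valid T S C y where
  completed : ∀ j ∈ S, j ≠ i → j ∈ A → before y j ((T j).deadline + 1) = (T j).workload
  unstarted : ∀ j ∈ S, j ≠ i → j ∉ A → ∀ v, y j v = 0
  packed : ∀ j ∈ S, j ≠ i → Packed T S C y j
  mono : ∀ v s, v ≤ s → s ≤ (T i).deadline → used S y v ≤ used S y s
  mono_erase : ∀ v s, v ≤ s → s ≤ (T i).deadline → used S y s < C →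
    used (S.erase i) y v ≤ used (S.erase i) y s

theorem used_eq_erase_add (hi : i ∈ S) (t : ℕ) :
    used S y t = used (S.erase i) y t + y i t :=
  (Finset.sum_erase_add _ _ hi).symm

theorem before_mono {q r : ℕ} (h : q ≤ r) : before y i q ≤ before y i r :=
  Finset.sum_le_sum_of_subset (Finset.Ico_subset_Ico_right h)

theorem before_succ {v : ℕ} (hv : 1 ≤ v) : before y i (v + 1) = before y i v + y i v :=
  Finset.sum_Ico_succ_top hv _

theorem before_congr {m : ℕ} (h : ∀ v < m, y i v = z i v) : before y i m = before z i m :=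
  Finset.sum_congr rfl fun v hv => h v (Finset.mem_Ico.1 hv).2

theorem eq_zero_of_before_eq_zero {m v : ℕ} (h : before y i m = 0) (hv : v ∈ Finset.Ico 1 m) :
    y i v = 0 :=
  Finset.sum_eq_zero_iff.1 h v hv

theorem Valid.apply_zero (hy : Valid T S C y) (hj : j ∈ S) : y j 0 = 0 :=
  hy.window j hj 0 (by simp)

theorem Valid.eq_zero_of_lt (hy : Valid T S C y) (hj : j ∈ S) {v : ℕ}
    (hv : (T j).deadline < v) : y j v = 0 :=
  hy.window j hj v fun h => absurd (Finset.mem_Icc.1 h).2 hv.not_ge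

/-- Some idle slot bounds any initial range of fully used slots: after the last deadline all
machines are idle. -/
theorem Valid.exists_idle (hy : Valid T S C y) (hC : 0 < C) (x : ℕ)
    (hx : ∀ s, 1 ≤ s → s ≤ x → C ≤ used S y s) :
    ∃ u, x ≤ u ∧ used S y (u + 1) < C ∧ ∀ s, 1 ≤ s → s ≤ u → C ≤ used S y s := by
  have hex : ∃ u, used S y (u + 1) < C := by
    refine ⟨S.sup fun j => (T j).deadline, ?_⟩
    have : used S y (S.sup (fun j => (T j).deadline) + 1) = 0 :=
      Finset.sum_eq_zero fun j hj => hy.eq_zero_of_lt hj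
        (Nat.lt_succ_of_le (Finset.le_sup (f := fun j => (T j).deadline) hj))
    omega
  classical
  refine ⟨Nat.find hex, ?_, Nat.find_spec hex, fun s hs hsu => ?_⟩
  · by_contra h
    have := hx (Nat.find hex + 1) (by omega) (by omega)
    have := Nat.find_spec hex
    omega
  · have := Nat.find_min hex (m := s - 1) (by omega)
    rw [Nat.sub_add_cancel hs] at this
    omega

/-- The heart of the optimality proof. Extend a fully used initial range to the largest one, say
`1, …, u`. There the packed tasks do only forced work, while task `i`, which runs at full
parallelism afterwards and is incomplete, does less. So more than `C u` units are forced. -/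
theorem InProgress.complete_of_full {A : Finset (Fin n)} (hy : InProgress T S C A i y)
    (hi : i ∈ S) (hB : ∀ u, forced T S u ≤ C * u) {x : ℕ}
    (hx : ∀ s, 1 ≤ s → s ≤ x → C ≤ used S y s)
    (hk : ∀ v, x < v → v ≤ (T i).deadline → y i v = (T i).bound) :
    (T i).workload ≤ before y i ((T i).deadline + 1) := by
  by_contra! hlt
  have tail : ∀ {j u}, j ∈ S → (∀ v, u + 1 ≤ v → v ≤ (T j).deadline → y j v = (T j).bound) →
      before y j ((T j).deadline + 1) =
        before y j (u + 1) + (T j).bound * ((T j).deadline - u) := by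
    intro j u hj h
    rw [before_eq_add u fun v hv => hy.eq_zero_of_lt hj hv,
      Finset.sum_congr rfl (g := fun _ => (T j).bound) fun v hv => by
        rw [Finset.mem_Ico] at hv
        exact h v hv.1 (by omega)]
    simp [mul_comm]
  -- Without machines no slot is idle, but then all the work of `i` is forced up to its deadline.
  rcases Nat.eq_zero_or_pos C with rfl | hC
  · have h₁ := hB (T i).deadline
    rw [zero_mul, Nat.le_zero, forced, Finset.sum_eq_zero_iff] at h₁
    have := h₁ i hi
    have := (T i).workload_pos
    simp at *
    omega
  obtain ⟨u, hxu, hu, hfull⟩ := hy.exists_idle hC x hx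
  have hCu : C * u ≤ ∑ j ∈ S, before y j (u + 1) := by
    unfold before
    rw [Finset.sum_comm]
    calc C * u = (Finset.Ico 1 (u + 1)).card • C := by simp [mul_comm]
      _ ≤ _ := Finset.card_nsmul_le_sum _ _ _ fun s hs => by
          rw [Finset.mem_Ico] at hs
          exact hfull s hs.1 (by omega)
  have hi' := tail (u := u) hi fun v hv hvd => hk v (by omega) hvd
  refine absurd (hB u) (not_le.2 (hCu.trans_lt ?_))
  refine Finset.sum_lt_sum (fun j hj => ?_) ⟨i, hi, by omega⟩
  rcases eq_or_ne j i with rfl | hji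
  · omega
  rcases hy.packed j hj hji (u + 1) hu with h | h
  · by_cases hjA : j ∈ A
    · have := tail hj h
      have := hy.completed j hj hji hjA
      omega
    · have h₀ : before y j (u + 1) = 0 :=
        Finset.sum_eq_zero fun v _ => hy.unstarted j hj hji hjA v
      omega
  · have h₀ : before y j (u + 1) = 0 :=
      Finset.sum_eq_zero fun v hv => h v (Finset.mem_Ico.1 hv).2
    omega

/-! ### Exchanges -/

/-- Give `w` more machines to task `i` at `t`. -/
def bump (y : Table n) (i : Fin n) (t w : ℕ) : Table n :=
  fun l v => y l v + if l = i ∧ v = t then w else 0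

/-- Move one unit of task `j` from slot `t` to slot `t'`. -/
def move (y : Table n) (j : Fin n) (t t' : ℕ) : Table n :=
  fun l v => y l v + (if l = j ∧ v = t' then 1 else 0) - if l = j ∧ v = t then 1 else 0

/-- Move one unit of task `j` from slot `t` to slot `t'`, and give the machine to task `i`. -/
def exchange (y : Table n) (i j : Fin n) (t t' : ℕ) : Table n :=
  bump (move y j t t') i t 1

theorem update_eq_bump {t w : ℕ} :
    Function.update y i (Function.update (y i) t (y i t + w)) = bump y i t w := by
  ext l v
  simp only [bump, Function.update_apply]
  split_ifs <;> simp_all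

theorem update_update_eq_move {t t' : ℕ} (h : t ≠ t') :
    Function.update (Function.update y j (Function.update (y j) t (y j t - 1))) j
      (Function.update
        (Function.update y j (Function.update (y j) t (y j t - 1)) j) t'
        (Function.update y j (Function.update (y j) t (y j t - 1)) j t' + 1)) =
      move y j t t' := by
  ext l v
  simp only [move, Function.update_apply]
  rcases eq_or_ne l j with rfl | hl
  · rcases eq_or_ne v t with rfl | hv
    · simp [h]
    · rcases eq_or_ne v t' with rfl | hv' <;> simp [*]
  · simp [hl]

theorem bump_zero {t : ℕ} : bump y i t 0 = y := by
  ext; simp [bump]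

theorem before_bump {t w m : ℕ} (ht : t ∈ Finset.Ico 1 m) :
    before (bump y i t w) i m = before y i m + w := by
  simp only [before, bump, Finset.sum_add_distrib, true_and, Finset.sum_ite_eq', if_pos ht]

theorem used_erase_bump {t w : ℕ} (v : ℕ) :
    used (S.erase i) (bump y i t w) v = used (S.erase i) y v :=
  Finset.sum_congr rfl fun l hl => by simp [bump, (Finset.mem_erase.1 hl).1]

theorem bump_of_ne {t w : ℕ} {l : Fin n} (hl : l ≠ i) : bump y i t w l = y l := by
  ext v
  simp [bump, hl]

theorem bump_self {t w : ℕ} (v : ℕ) : bump y i t w i v = y i v + if v = t then w else 0 := by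
  simp [bump]

theorem bump_move {t t' w : ℕ} (hji : j ≠ i) :
    bump (move y j t t') i t (w + 1) = exchange (bump y i t w) i j t t' := by
  ext l v
  simp only [exchange, bump, move]
  split_ifs <;> simp_all
  omega

theorem move_self {t t' : ℕ} (hji : j ≠ i) : move y j t t' i = y i := by
  ext v
  simp [move, hji.symm]

theorem used_bump (hi : i ∈ S) {t w : ℕ} (v : ℕ) :
    used S (bump y i t w) v = used S y v + if v = t then w else 0 := by
  simp only [used, bump, Finset.sum_add_distrib, ite_and]
  rw [Finset.sum_ite_eq' S i, if_pos hi]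

theorem used_move (hj : j ∈ S) {t t' : ℕ} (h : 0 < y j t) (v : ℕ) :
    used S (move y j t t') v + (if v = t then 1 else 0) =
      used S y v + if v = t' then 1 else 0 := by
  have key : ∑ l ∈ S, (move y j t t' l v + if l = j then (if v = t then 1 else 0) else 0) =
      ∑ l ∈ S, (y l v + if l = j then (if v = t' then 1 else 0) else 0) := by
    refine Finset.sum_congr rfl fun l _ => ?_
    rw [move]
    split_ifs <;> simp_all
    omega
  rw [Finset.sum_add_distrib, Finset.sum_add_distrib, Finset.sum_ite_eq' S j,
    Finset.sum_ite_eq' S j, if_pos hj, if_pos hj] at key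
  exact key

theorem used_exchange (hi : i ∈ S) (hj : j ∈ S) {t t' : ℕ} (h : 0 < y j t) (v : ℕ) :
    used S (exchange y i j t t') v = used S y v + if v = t' then 1 else 0 := by
  rw [exchange, used_bump hi, ← used_move hj h]

theorem used_erase_exchange (hj : j ∈ S) (hji : j ≠ i) {t t' : ℕ} (h : 0 < y j t) (v : ℕ) :
    used (S.erase i) (exchange y i j t t') v + (if v = t then 1 else 0) =
      used (S.erase i) y v + if v = t' then 1 else 0 := by
  rw [← used_move (Finset.mem_erase.2 ⟨hji, hj⟩) h]
  congr 1
  refine Finset.sum_congr rfl fun l hl => ?_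
  simp [exchange, bump, (Finset.mem_erase.1 hl).1]

theorem exchange_of_ne {l : Fin n} (hli : l ≠ i) (hlj : l ≠ j) {t t' : ℕ} :
    exchange y i j t t' l = y l := by
  ext v
  simp [exchange, bump, move, hli, hlj]

theorem exchange_left {t t' : ℕ} (hji : j ≠ i) (v : ℕ) :
    exchange y i j t t' i v = y i v + if v = t then 1 else 0 := by
  simp [exchange, bump, move, hji.symm]

theorem exchange_right {t t' : ℕ} (hji : j ≠ i) (v : ℕ) :
    exchange y i j t t' j v = y j v + (if v = t' then 1 else 0) - if v = t then 1 else 0 := by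
  simp [exchange, bump, move, hji]

theorem before_exchange {t t' m : ℕ} (hji : j ≠ i) (h : 0 < y j t)
    (ht : t ∈ Finset.Ico 1 m) (ht' : t' ∈ Finset.Ico 1 m) :
    before (exchange y i j t t') j m = before y j m := by
  have key : ∑ v ∈ Finset.Ico 1 m, (exchange y i j t t' j v + if v = t then 1 else 0) =
      ∑ v ∈ Finset.Ico 1 m, (y j v + if v = t' then 1 else 0) := by
    refine Finset.sum_congr rfl fun v _ => ?_
    rw [exchange_right hji]
    split_ifs <;> simp_all
    omega
  rw [Finset.sum_add_distrib, Finset.sum_add_distrib, Finset.sum_ite_eq', Finset.sum_ite_eq',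
    if_pos ht, if_pos ht'] at key
  exact Nat.add_right_cancel key

/-- Idle machines may be given to `i` at `t` if the load stays monotone. -/
theorem InProgress.bump (hy : InProgress T S C A i y) (hi : i ∈ S) {t w : ℕ} (ht : 1 ≤ t)
    (htd : t ≤ (T i).deadline) (hC : used S y t + w ≤ C) (hk : y i t + w ≤ (T i).bound)
    (hmono : ∀ s, t < s → s ≤ (T i).deadline → used S y t + w ≤ used S y s) :
    InProgress T S C A i (bump y i t w) := by
  have hused := used_bump (y := y) hi (t := t) (w := w)
  refine ⟨⟨?_, ?_, ?_⟩, ?_, ?_, ?_, ?_, ?_⟩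
  · intro l hl v hv
    have h₀ := hy.window l hl v hv
    rcases eq_or_ne l i with rfl | hli
    · rw [Finset.mem_Icc] at hv
      rw [bump_self, h₀, if_neg (by omega)]
    · rwa [bump_of_ne hli]
  · intro l hl v
    have h₀ := hy.parallelism l hl v
    rcases eq_or_ne l i with rfl | hli
    · rw [bump_self]
      split_ifs with h
      · rwa [h]
      · exact h₀
    · rwa [bump_of_ne hli]
  · intro v
    have := hy.capacity v
    rw [hused]
    split_ifs with h
    · rwa [h]
    · exact this
  · intro l hl hli hlA
    rw [← hy.completed l hl hli hlA]
    exact before_congr fun v _ => by rw [bump_of_ne hli]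
  · intro l hl hli hlA v
    rw [bump_of_ne hli, hy.unstarted l hl hli hlA]
  · intro l hl hli s hs
    rw [bump_of_ne hli]
    rw [hused] at hs
    exact hy.packed l hl hli s (by omega)
  · intro v s hvs hsd
    have h₀ := hy.mono v s hvs hsd
    rw [hused, hused]
    rcases eq_or_ne v t with rfl | hv
    · rcases hvs.eq_or_lt with rfl | hvs'
      · rfl
      · have := hmono s hvs' hsd
        simp only [if_true]
        omega
    · simp only [hv, if_false]
      omega
  · intro v s hvs hsd hs
    rw [used_erase_bump, used_erase_bump]
    rw [hused] at hs
    exact hy.mono_erase v s hvs hsd (by omega)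

/-- Exchanges towards the latest slot `t'` with an idle machine keep the invariant. The moved task
`j` does not run at full parallelism in `t'`, so it has no work before `t'` and stays packed. -/
theorem InProgress.exchange {A : Finset (Fin n)} (hz : InProgress T S C A i z) (hi : i ∈ S)
    (hj : j ∈ S) (hji : j ≠ i) {t t' : ℕ} (ht' : 1 ≤ t') (htt : t' < t)
    (htd : t ≤ (T i).deadline) (hidle : used S z t' < C)
    (hfull : ∀ s, t' < s → s ≤ (T i).deadline → C ≤ used S z s)
    (hlt : z j t' < z j t) (hik : z i t < (T i).bound) :
    InProgress T S C A i (exchange z i j t t') := by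
  have hpos : 0 < z j t := by omega
  have hused := used_exchange (t' := t') hi hj hpos
  have hrest := used_erase_exchange (i := i) (t' := t') hj hji hpos
  have hjt := hz.parallelism j hj t
  have htj : t ≤ (T j).deadline := by
    by_contra h
    have := hz.eq_zero_of_lt hj (v := t) (by omega)
    omega
  have hnew : ∀ s, used S (Malleable.exchange z i j t t') s < C → used S z s < C := fun s hs => by
    rw [hused] at hs
    omega
  refine ⟨⟨?_, ?_, ?_⟩, ?_, ?_, ?_, ?_, ?_⟩
  · intro l hl v hv
    rw [Finset.mem_Icc] at hv
    have h₀ := hz.window l hl v (by rwa [Finset.mem_Icc])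
    rcases eq_or_ne l i with rfl | hli
    · rw [exchange_left hji, h₀, if_neg (by omega)]
    rcases eq_or_ne l j with rfl | hlj
    · rw [exchange_right hji, h₀, if_neg (by omega)]
      omega
    · rwa [exchange_of_ne hli hlj]
  · intro l hl v
    have h₀ := hz.parallelism l hl v
    rcases eq_or_ne l i with rfl | hli
    · rw [exchange_left hji]
      split_ifs with h
      · subst h
        omega
      · exact h₀
    rcases eq_or_ne l j with rfl | hlj
    · rw [exchange_right hji]
      rcases eq_or_ne v t' with rfl | h
      · simp
        omega
      · simp [h]
        omega
    · rwa [exchange_of_ne hli hlj]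
  · intro v
    rw [hused]
    have := hz.capacity v
    split_ifs with h
    · subst h
      omega
    · exact this
  · intro l hl hli hlA
    rw [← hz.completed l hl hli hlA]
    rcases eq_or_ne l j with rfl | hlj
    · exact before_exchange hji hpos (Finset.mem_Ico.2 ⟨by omega, by omega⟩)
        (Finset.mem_Ico.2 ⟨by omega, by omega⟩)
    · exact before_congr fun v _ => by rw [exchange_of_ne hli hlj]
  · intro l hl hli hlA v
    have h₀ := hz.unstarted l hl hli hlA
    rcases eq_or_ne l j with rfl | hlj
    · simp [h₀] at hpos
    · rw [exchange_of_ne hli hlj, h₀]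
  · intro l hl hli s hs
    rcases eq_or_ne l j with rfl | hlj
    · rcases le_or_gt s t' with hst | hst
      · right
        intro v hv
        rw [exchange_right hji]
        rcases hz.packed l hl hli t' hidle with h | h
        · have := h t' le_rfl (by omega)
          omega
        · rw [h v (by omega), if_neg (by omega)]
          omega
      · have hsd : (T i).deadline < s := by
          by_contra h
          have := hfull s hst (by omega)
          have := hnew s hs
          omega
        rcases hz.packed l hl hli s (hnew s hs) with h | h
        · left
          intro v hsv hv
          rw [exchange_right hji, h v hsv hv, if_neg (by omega), if_neg (by omega)]
          omega
        · have := h t (by omega)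
          omega
    · rw [exchange_of_ne hli hlj]
      exact hz.packed l hl hli s (hnew s hs)
  · intro v s hvs hsd
    have h₀ := hz.mono v s hvs hsd
    rw [hused, hused]
    rcases eq_or_ne v t' with rfl | hv
    · rcases hvs.eq_or_lt with rfl | hvs'
      · rfl
      · have := hfull s hvs' hsd
        simp only [if_true]
        omega
    · simp only [hv, if_false]
      omega
  · intro v s hvs hsd hs
    have hst : s ≤ t' := by
      by_contra h
      have := hfull s (by omega) hsd
      have := hnew s hs
      omega
    rcases hvs.eq_or_lt with rfl | hvs'
    · rfl
    have h₀ := hz.mono_erase v s hvs hsd (hnew s hs)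
    have h₁ := hrest v
    have h₂ := hrest s
    rw [if_neg (by omega), if_neg (by omega)] at h₁
    rw [if_neg (by omega)] at h₂
    omega

/-! ### Removing the earliest units -/

/-- Remove `θ` units of task `i`, the earliest first. From slot `v` those units are removed that
the slots before `v` do not supply. -/
def trim (y : Table n) (i : Fin n) (θ : ℕ) : Table n :=
  Function.update y i fun v => y i v - (θ - before y i v)

theorem trim_self {θ : ℕ} (v : ℕ) : trim y i θ i v = y i v - (θ - before y i v) := by
  simp [trim]

theorem trim_of_ne {θ : ℕ} (h : j ≠ i) : trim y i θ j = y j := by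
  simp [trim, h]

theorem before_trim {θ m : ℕ} : before (trim y i θ) i m = before y i m - θ := by
  rcases Nat.eq_zero_or_pos m with rfl | hm
  · simp [before]
  induction m, hm using Nat.le_induction with
  | base => simp [before]
  | succ m hm ih =>
    rw [before_succ hm, before_succ hm, ih, trim_self]
    omega

theorem trim_eq_self_of_le {θ v : ℕ} (h : θ ≤ before y i v) : trim y i θ i v = y i v := by
  rw [trim_self, Nat.sub_eq_zero_of_le h, Nat.sub_zero]

theorem trim_eq_zero_of_le {θ s v : ℕ} (h₀ : y i 0 = 0) (h : before y i s ≤ θ) (hv : v < s) :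
    trim y i θ i v = 0 := by
  rw [trim_self]
  rcases Nat.eq_zero_or_pos v with rfl | hv'
  · omega
  have h₁ := before_succ (y := y) (i := i) hv'
  have h₂ := before_mono (y := y) (i := i) (q := v + 1) (r := s) hv
  omega

theorem used_trim_le {θ : ℕ} (v : ℕ) : used S (trim y i θ) v ≤ used S y v := by
  refine Finset.sum_le_sum fun j _ => ?_
  rcases eq_or_ne j i with rfl | h
  · rw [trim_self]
    omega
  · rw [trim_of_ne h]

theorem used_trim_of_le {θ v : ℕ} (h : θ ≤ before y i v) :
    used S (trim y i θ) v = used S y v := by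
  refine Finset.sum_congr rfl fun j _ => ?_
  rcases eq_or_ne j i with rfl | hj
  · exact trim_eq_self_of_le h
  · rw [trim_of_ne hj]

theorem used_erase_trim {θ : ℕ} (v : ℕ) :
    used (S.erase i) (trim y i θ) v = used (S.erase i) y v :=
  Finset.sum_congr rfl fun j hj => by rw [trim_of_ne (Finset.mem_erase.1 hj).1]

theorem used_lt_of_used_trim_lt {θ q : ℕ} (hq : θ ≤ before y i q)
    (hidle : ∀ v < q, used S y v < C) {s : ℕ} (hs : used S (trim y i θ) s < C) :
    used S y s < C := by
  rcases lt_or_ge s q with h | h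
  · exact hidle s h
  · rwa [used_trim_of_le (hq.trans (before_mono h))] at hs

/-- Units of `i` may be removed from slots that have an idle machine anyway: no new conditions for
the packing of other tasks arise. -/
theorem InProgress.trim {A : Finset (Fin n)} (hz : InProgress T S C A i z) (hi : i ∈ S)
    {θ q : ℕ} (hq : θ ≤ before z i q) (hidle : ∀ v < q, used S z v < C) :
    InProgress T S C A i (trim z i θ) := by
  refine ⟨⟨?_, ?_, ?_⟩, ?_, ?_, ?_, ?_, ?_⟩
  · intro l hl v hv
    have h₀ := hz.window l hl v hv
    rcases eq_or_ne l i with rfl | hli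
    · rw [trim_self, h₀, Nat.zero_sub]
    · rwa [trim_of_ne hli]
  · intro l hl v
    have h₀ := hz.parallelism l hl v
    rcases eq_or_ne l i with rfl | hli
    · rw [trim_self]
      omega
    · rwa [trim_of_ne hli]
  · exact fun v => (used_trim_le v).trans (hz.capacity v)
  · intro l hl hli hlA
    rw [← hz.completed l hl hli hlA]
    exact before_congr fun v _ => by rw [trim_of_ne hli]
  · intro l hl hli hlA v
    rw [trim_of_ne hli, hz.unstarted l hl hli hlA]
  · intro l hl hli s hs
    rw [trim_of_ne hli]
    exact hz.packed l hl hli s (used_lt_of_used_trim_lt hq hidle hs)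
  · intro v s hvs hsd
    rcases hvs.eq_or_lt with rfl | hvs'
    · rfl
    rcases le_or_gt θ (before z i s) with h | h
    · rw [used_trim_of_le h]
      exact (used_trim_le v).trans (hz.mono v s hvs hsd)
    · -- All units of `i` before `s` are removed, so the load of the other tasks decides.
      have hsq : s < q := by
        by_contra h'
        have := before_mono (y := z) (i := i) (not_lt.1 h')
        omega
      have h₁ := hz.mono_erase v s hvs hsd (hidle s hsq)
      rw [used_eq_erase_add hi, used_eq_erase_add hi, used_erase_trim, used_erase_trim,
        trim_eq_zero_of_le (hz.apply_zero hi) h.le hvs']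
      omega
  · intro v s hvs hsd hs
    rw [used_erase_trim, used_erase_trim]
    exact hz.mono_erase v s hvs hsd (used_lt_of_used_trim_lt hq hidle hs)

end Packed

/-! ### Correctness of the subroutines -/

section Correctness

variable {n : ℕ} {T : Fin n → Task} {S A : Finset (Fin n)} {C : ℕ} {y : Table n} {i : Fin n}

theorem ensures_removeEarliest {θ : ℕ} {Q : Unit → Table n → Prop} (h₀ : y i 0 = 0)
    (hθ : θ ≤ before y i ((T i).deadline + 1)) (hQ : Q () (trim y i θ)) :
    Ensures (removeEarliest T i θ) y Q := by
  simp only [removeEarliest, ensures_bind, ensures_tick]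
  split_ifs with hpos
  · simp only [ensures_bind]
    refine ensures_findSlot hpos ?_ fun u hu h₁ h₂ => ?_
    · rw [zero_add, add_comm 1]
      exact hθ
    simp only [zero_add] at h₁ h₂ ⊢
    change before y i u < θ at h₁
    change θ ≤ before y i u + y i u at h₂
    simp only [ensures_read, ensures_tick, ensures_write, ensures_clearSlots]
    convert hQ using 1
    ext l v
    rcases eq_or_ne l i with rfl | hl
    · rw [trim_self]
      simp only [Function.update_self, Function.update_apply, Finset.mem_Icc]
      rcases Nat.eq_zero_or_pos v with rfl | hv
      · simp [h₀]
        intro h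
        omega
      rcases lt_trichotomy v u with h | rfl | h
      · rw [if_pos (by omega)]
        have h₃ := before_succ (y := y) (i := l) hv
        have h₄ := before_mono (y := y) (i := l) (q := v + 1) (r := u) h
        omega
      · rw [if_neg (by omega), if_pos rfl]
        rfl
      · rw [if_neg (by omega), if_neg (by omega)]
        have h₃ := before_succ (y := y) (i := l) hu
        have h₄ := before_mono (y := y) (i := l) (q := u + 1) (r := v) h
        omega
    · simp [trim, hl]
  · obtain rfl : θ = 0 := by omega
    rw [ensures_pure]
    convert hQ using 1
    ext l v
    rcases eq_or_ne l i with rfl | hl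
    · simp [trim]
    · simp [trim, hl]

/-- The state of `routine` for task `i` at slot `t`, called with the table `y`, when `w` machines
are idle at `t`. The table `z` is the current one with these machines already given to `i`. -/
structure Filling (T : Fin n → Task) (S A : Finset (Fin n)) (C : ℕ) (i : Fin n) (t Δ : ℕ)
    (b : Bool) (y z : Table n) (w : ℕ) : Prop where
  inProgress : InProgress T S C A i z
  apply_self : z i t = y i t + w
  apply_of_ne : ∀ v, v ≠ t → z i v = y i v
  used_le : ∀ s, used S y s ≤ used S z s
  used_self : C ≤ used S z t
  le : w ≤ Δ
  /-- the `w` earliest units of `i` lie in slots that have an idle machine -/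
  earlier : b = true → ∃ q ≤ t, w ≤ before y i q ∧ ∀ v < q, used S z v < C

/-- The result of `routine`, with the reason why it stopped. -/
structure Filled (T : Fin n → Task) (S A : Finset (Fin n)) (C : ℕ) (i : Fin n) (t Δ : ℕ)
    (b : Bool) (y z : Table n) (w : ℕ) : Prop extends Filling T S A C i t Δ b y z w where
  reason : w = Δ ∨ (∀ s, 1 ≤ s → s < t → C ≤ used S z s) ∨
    b = true ∧ ∀ s < t, used S z s < C → before y i s ≤ w

/-- The loop of `routine`, started when `w` machines are idle at `t` and more than `Δ - w` passes
are left. In every slot before `t` that can be chosen, task `i` runs at full parallelism (`hown`).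
Hence `i` itself is never moved, and, by counting, some other task can be. -/
theorem ensures_routineLoop {t Δ fuel : ℕ} {b : Bool} (hi : i ∈ S) (htd : t ≤ (T i).deadline)
    {y₀ : Table n} (hΔ : y₀ i t + Δ ≤ (T i).bound)
    (hafter : ∀ s, t < s → s ≤ (T i).deadline → C ≤ used S y₀ s)
    (hown : ∀ s < t, 1 ≤ s → used S y₀ s < C → (b = true → 0 < before y₀ i s) →
      y₀ i s = (T i).bound)
    {w : ℕ} (hfuel : Δ < fuel + w) (hrow : y i = y₀ i) (hw : used S y t + w = C)
    (hz : Filling T S A C i t Δ b y₀ (bump y i t w) w) :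
    Ensures (routineLoop S C i t Δ b fuel) y fun _ y' =>
      ∃ w', y' i = y₀ i ∧ used S y' t + w' = C ∧
        Filled T S A C i t Δ b y₀ (bump y' i t w') w' := by
  induction fuel generalizing y w with
  | zero => have := hz.le; omega
  | succ fuel ih =>
    have hused : ∀ s, s ≠ t → used S (bump y i t w) s = used S y s := fun s hs => by
      simp [used_bump hi, hs]
    have hbefore : ∀ m, before y i m = before y₀ i m := fun m =>
      before_congr fun v _ => by rw [hrow]
    simp only [routineLoop, ensures_bind, ensures_tick, ensures_avail]
    split_ifs with hwΔ
    swap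
    · rw [ensures_pure]
      exact ⟨w, hrow, hw, hz, .inl (by have := hz.le; omega)⟩
    rw [ensures_bind]
    refine ensures_latestIdle (fun hfull => ?_) fun t' ht' hidle hlatest => ?_
    · simp only [ensures_pure]
      refine ⟨w, hrow, hw, hz, .inr (.inl fun s hs hst => ?_)⟩
      rw [hused s hst.ne]
      exact hfull s (Finset.mem_Icc.2 ⟨hs, by omega⟩)
    rw [Finset.mem_Icc] at ht'
    have htt : t' < t := by omega
    have hsum : ∑ v ∈ Finset.Ico (0 + 1) (0 + (t' - 1) + 1), y i v = before y₀ i t' := by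
      rw [← hbefore, before, zero_add, zero_add, Nat.sub_add_cancel ht'.1]
    -- `t'` is the latest slot up to the deadline of `i` with an idle machine.
    have hlater : ∀ s, t' < s → s ≤ (T i).deadline → C ≤ used S (bump y i t w) s := by
      intro s hs hsd
      rcases lt_trichotomy s t with h | rfl | h
      · rw [hused s h.ne]
        exact hlatest s hs (by omega)
      · exact hz.used_self
      · exact (hafter s h hsd).trans (hz.used_le s)
    simp only [ensures_bind, ensures_sumSlots, ensures_tick, hsum]
    split_ifs with hexit
    · rw [ensures_pure]
      refine ⟨w, hrow, hw, hz, .inr (.inr ⟨hexit.1, fun s hst hs => ?_⟩)⟩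
      have hst' : s ≤ t' := by
        by_contra h
        have := hlater s (by omega) (by omega)
        omega
      have := before_mono (y := y₀) (i := i) hst'
      omega
    have hkt' : y i t' = (T i).bound := by
      rw [hrow]
      refine hown t' htt ht'.1 ?_ fun hb => ?_
      · have := hz.used_le t'
        rw [hused t' htt.ne] at this
        omega
      · by_contra h
        exact hexit ⟨hb, by omega⟩
    have hit : y i t + Δ ≤ (T i).bound := by rwa [hrow]
    rw [ensures_bind, ensures_listing]
    rintro l - rfl
    rw [ensures_bind]
    refine ensures_findTask (fun hnone => ?_) fun j hj hlt => ?_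
    · -- Apart from `i`, more machines are in use at `t` than at `t'`.
      exfalso
      have h₁ : used (l.toFinset.erase i) y t ≤ used (l.toFinset.erase i) y t' :=
        Finset.sum_le_sum fun j hj =>
          hnone j (List.mem_toFinset.1 (Finset.mem_of_mem_erase hj))
      have h₂ := used_eq_erase_add (y := y) hi t
      have h₃ := used_eq_erase_add (y := y) hi t'
      omega
    have hj' : j ∈ l.toFinset := List.mem_toFinset.2 hj
    have hji : j ≠ i := by
      rintro rfl
      omega
    have hpos : 0 < y j t := by omega
    have hbj : ∀ v, bump y i t w j v = y j v := fun v => by simp [bump, hji]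
    have hpos' : 0 < bump y i t w j t := by rwa [hbj]
    simp only [ensures_bind, ensures_tick, ensures_read, ensures_write,
      update_update_eq_move htt.ne']
    have hex : bump (move y j t t') i t (w + 1) = exchange (bump y i t w) i j t t' :=
      bump_move hji
    have hidle' : used l.toFinset (bump y i t w) t' < C := by rwa [hused t' htt.ne]
    have hused' := fun s => used_exchange (t' := t') hi hj' hpos' s
    have hmono := hz.inProgress.mono
    refine ih (w := w + 1) (by omega) (by rw [move_self hji, hrow]) ?_ ?_
    · have := used_move hj' (t' := t') hpos t
      rw [if_pos rfl, if_neg htt.ne'] at this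
      omega
    rw [hex]
    refine ⟨hz.inProgress.exchange hi hj' hji ht'.1 htt htd hidle' hlater ?_ ?_, ?_, ?_, ?_, ?_,
      by omega, fun hb => ⟨t', htt.le, ?_, fun v hv => ?_⟩⟩
    · rwa [hbj, hbj]
    · have := hz.apply_self
      rw [← hrow] at this
      omega
    · rw [exchange_left hji, hz.apply_self, if_pos rfl, add_assoc]
    · intro v hv
      rw [exchange_left hji, hz.apply_of_ne v hv, if_neg hv, add_zero]
    · intro s
      have := hz.used_le s
      rw [hused']
      omega
    · have := hz.used_self
      rw [hused']
      omega
    · by_contra h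
      exact hexit ⟨hb, by omega⟩
    · have := hmono v t' hv.le (by omega)
      rw [hused', if_neg hv.ne]
      omega

/-- `routine`, followed by the assignment of the machines that have become idle at `t` to `i`. -/
theorem ensures_routine {t Δ : ℕ} {b : Bool} (hi : i ∈ S) (htd : t ≤ (T i).deadline)
    (hΔ : y i t + Δ ≤ (T i).bound) (hy : InProgress T S C A i y)
    (hfull : ∀ s, t ≤ s → s ≤ (T i).deadline → C ≤ used S y s)
    (hown : ∀ s < t, 1 ≤ s → used S y s < C → (b = true → 0 < before y i s) →
      y i s = (T i).bound) :
    Ensures (routine S C i t Δ b) y fun _ y' =>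
      Filled T S A C i t Δ b y
        (Function.update y' i (Function.update (y' i) t (y' i t + (C - used S y' t))))
        (C - used S y' t) := by
  have hut : used S y t = C := (hy.capacity t).antisymm (hfull t le_rfl htd)
  have h₀ : Filling T S A C i t Δ b y (bump y i t 0) 0 := by
    rw [bump_zero]
    exact ⟨hy, rfl, fun _ _ => rfl, fun _ => le_rfl, hut.ge, Nat.zero_le _,
      fun _ => ⟨0, Nat.zero_le _, Nat.zero_le _, by simp⟩⟩
  refine Ensures.mono (ensures_routineLoop hi htd hΔ (fun s hs => hfull s hs.le) hown
    (fuel := Δ + 1) (by omega) rfl (by omega) h₀) ?_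
  rintro - y' ⟨w, -, hw, hz⟩
  rw [update_eq_bump]
  obtain rfl : w = C - used S y' t := by omega
  exact hz

end Correctness

/-! ### Correctness of LDF -/

section LDF

variable {n : ℕ} {T : Fin n → Task} {S A : Finset (Fin n)} {C : ℕ} {y z : Table n} {i : Fin n}

/-- Up to its deadline, task `i` runs at full parallelism in every slot that has an idle machine
and is preceded by work of `i`. In contrast to `Packed`, later slots are not mentioned. -/
def LocallyPacked (T : Fin n → Task) (S : Finset (Fin n)) (C : ℕ) (y : Table n) (i : Fin n) :
    Prop :=
  ∀ s ≤ (T i).deadline, used S y s < C → y i s = (T i).bound ∨ ∀ v < s, y i v = 0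

/-- The state of `fullyUtilize` when the slots `t, …, 1` are left. -/
structure Utilized (T : Fin n → Task) (S A : Finset (Fin n)) (C : ℕ) (i : Fin n) (t : ℕ)
    (y : Table n) : Prop where
  inProgress : InProgress T S C A i y
  eq_zero : ∀ v ≤ t, y i v = 0
  locallyPacked : LocallyPacked T S C y i
  before_le : before y i ((T i).deadline + 1) ≤ (T i).workload
  short : before y i ((T i).deadline + 1) = (T i).workload ∨
    ∀ s, t < s → s ≤ (T i).deadline → used S y s < C → y i s = (T i).bound

theorem ensures_fullyUtilize (hi : i ∈ S) {t : ℕ} (htd : t ≤ (T i).deadline)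
    (hy : Utilized T S A C i t y) :
    Ensures (fullyUtilize T S C i t) y fun _ y' => Utilized T S A C i 0 y' := by
  induction t generalizing y with
  | zero => exact ensures_tick.2 hy
  | succ t ih =>
    simp only [fullyUtilize, ensures_bind, ensures_sumSlots, ensures_avail, ensures_tick,
      ensures_write]
    have hsum : ∑ v ∈ Finset.Ico (t + 1 + 1) (t + 1 + ((T i).deadline - (t + 1)) + 1), y i v =
        before y i ((T i).deadline + 1) := by
      have h₀ : before y i (t + 1 + 1) = 0 :=
        Finset.sum_eq_zero fun v hv => hy.eq_zero v (by rw [Finset.mem_Ico] at hv; omega)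
      rw [before_eq_add (t + 1) fun v hv => hy.inProgress.eq_zero_of_lt hi hv, h₀, zero_add,
        show t + 1 + ((T i).deadline - (t + 1)) + 1 = (T i).deadline + 1 by omega]
    rw [hsum]
    obtain ⟨w, hw⟩ : ∃ w, w = min (T i).bound (min
      ((T i).workload - before y i ((T i).deadline + 1)) (C - used S y (t + 1))) := ⟨_, rfl⟩
    rw [← hw]
    have hzero := hy.eq_zero (t + 1) le_rfl
    have hbump : Function.update y i (Function.update (y i) (t + 1) w) = bump y i (t + 1) w := by
      rw [← update_eq_bump, hzero, zero_add]
    rw [hbump]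
    have hcap := hy.inProgress.capacity (t + 1)
    have hbefore := before_bump (y := y) (i := i) (t := t + 1) (w := w)
      (m := (T i).deadline + 1) (Finset.mem_Ico.2 ⟨by omega, by omega⟩)
    have hused := used_bump (y := y) hi (t := t + 1) (w := w)
    have hle := hy.before_le
    refine ih (by omega) ⟨hy.inProgress.bump hi (by omega) htd (by omega) (by omega) ?_,
      ?_, ?_, by omega, ?_⟩
    · intro s hts hsd
      have h₁ := hy.inProgress.mono (t + 1) s hts.le hsd
      rcases hy.short with h | h
      · omega
      rcases le_or_gt C (used S y s) with hs | hs
      · omega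
      · have h₂ := hy.inProgress.mono_erase (t + 1) s hts.le hsd hs
        have h₃ := h s hts hsd hs
        rw [used_eq_erase_add hi] at hs ⊢
        rw [used_eq_erase_add hi]
        omega
    · intro v hv
      rw [bump_self, hy.eq_zero v (by omega), if_neg (by omega)]
    · intro s hsd hs
      rcases le_or_gt s (t + 1) with hst | hst
      · right
        intro v hv
        rw [bump_self, hy.eq_zero v (by omega), if_neg (by omega)]
      · rw [hused, if_neg (by omega)] at hs
        rw [bump_self, if_neg (by omega)]
        rcases hy.short with h | h
        · obtain rfl : w = 0 := by omega
          rw [bump_zero]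
          exact hy.locallyPacked s hsd hs
        · exact .inl (h s hst hsd hs)
    · rcases hy.short with h | h
      · left
        omega
      rcases eq_or_ne (before y i ((T i).deadline + 1) + w) (T i).workload with hD | hD
      · left
        omega
      right
      intro s hts hsd hs
      rw [hused] at hs
      rw [bump_self]
      rcases eq_or_ne s (t + 1) with rfl | hst
      · rw [if_pos rfl] at hs ⊢
        omega
      · rw [if_neg hst] at hs ⊢
        exact h s (by omega) hsd (by omega)

theorem Filling.before_eq {t Δ w m : ℕ} {b : Bool} (h : Filling T S A C i t Δ b y z w)
    (ht : t ∈ Finset.Ico 1 m) : before z i m = before y i m + w := by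
  rw [← before_bump ht]
  refine before_congr fun v _ => ?_
  rw [bump_self]
  split_ifs with hv
  · rw [hv, h.apply_self]
  · exact h.apply_of_ne v hv

theorem Filling.before_eq_of_le {t Δ w m : ℕ} {b : Bool} (h : Filling T S A C i t Δ b y z w)
    (hm : m ≤ t) : before z i m = before y i m :=
  before_congr fun v hv => h.apply_of_ne v (by omega)

/-- While work of `i` is missing, `i` runs at full parallelism in all slots with an idle machine
and in all slots after `t`. If `routine` finds no idle machine left, then
`InProgress.complete_of_full` contradicts the boundary condition. -/
theorem ensures_fullyAllocateLoop (hi : i ∈ S) (hB : ∀ u, forced T S u ≤ C * u) {t Ω : ℕ}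
    (htd : t ≤ (T i).deadline) (hy : InProgress T S C A i y)
    (hloc : LocallyPacked T S C y i)
    (hΩ : before y i ((T i).deadline + 1) + Ω = (T i).workload)
    (hidle : 0 < Ω → ∀ s, 1 ≤ s → s ≤ (T i).deadline → used S y s < C → y i s = (T i).bound)
    (hafter : 0 < Ω → ∀ s, t < s → s ≤ (T i).deadline → y i s = (T i).bound) :
    Ensures (fullyAllocateLoop T S C i t Ω) y fun _ y' => InProgress T S C A i y' ∧
      LocallyPacked T S C y' i ∧ before y' i ((T i).deadline + 1) = (T i).workload := by
  induction t generalizing y Ω with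
  | zero =>
    refine ensures_tick.2 ⟨hy, hloc, ?_⟩
    rcases Nat.eq_zero_or_pos Ω with rfl | hpos
    · exact hΩ
    · have := hy.complete_of_full hi hB (x := 0) (by omega) (hafter hpos)
      omega
  | succ t ih =>
    simp only [fullyAllocateLoop, ensures_bind, ensures_tick]
    split_ifs with hpos
    swap
    · exact ensures_pure.2 ⟨hy, hloc, by omega⟩
    simp only [ensures_bind, ensures_read, ensures_tick]
    have hyk := hy.parallelism i hi (t + 1)
    split_ifs with hΔ
    swap
    · refine ih (by omega) hy hloc hΩ hidle fun _ s hs hsd => ?_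
      rcases eq_or_ne s (t + 1) with rfl | hst
      · omega
      · exact hafter hpos s (by omega) hsd
    simp only [ensures_bind, ensures_avail, ensures_read, ensures_tick, ensures_write]
    have hfull : ∀ s, t + 1 ≤ s → s ≤ (T i).deadline → C ≤ used S y s := by
      intro s hs hsd
      refine le_trans ?_ (hy.mono (t + 1) s hs hsd)
      by_contra h
      have := hidle hpos (t + 1) (by omega) htd (by omega)
      omega
    refine (ensures_routine (A := A) hi htd (by omega) hy hfull
      fun s hs hs₁ hsC _ => hidle hpos s hs₁ (by omega) hsC).mono fun _ y' hz => ?_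
    generalize Function.update y' i _ = z at hz ⊢
    generalize C - used S y' (t + 1) = w at hz ⊢
    have hw := hz.le
    have hbefore := hz.before_eq (m := (T i).deadline + 1)
      (Finset.mem_Ico.2 ⟨by omega, by omega⟩)
    have hidle' : ∀ s, 1 ≤ s → s ≤ (T i).deadline → used S z s < C → z i s = (T i).bound := by
      intro s hs hsd hsC
      have h₁ := hz.used_le s
      rcases eq_or_ne s (t + 1) with rfl | hst
      · have := hz.used_self
        omega
      · rw [hz.apply_of_ne s hst]
        exact hidle hpos s hs hsd (by omega)
    refine ih (by omega) hz.inProgress (fun s hsd hs => ?_) (by omega) (fun _ => hidle')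
      fun hΩ' s hs hsd => ?_
    · rcases Nat.eq_zero_or_pos s with rfl | hs₁
      · exact .inr (by simp)
      · exact .inl (hidle' s hs₁ hsd hs)
    · rcases hz.reason with hexit | hexit | hexit
      · rcases eq_or_ne s (t + 1) with rfl | hst
        · rw [hz.apply_self]
          omega
        · rw [hz.apply_of_ne s hst]
          exact hafter hpos s (by omega) hsd
      · have := hz.inProgress.complete_of_full hi hB (x := (T i).deadline) (fun s hs hsd => ?_)
          (by omega)
        · omega
        · rcases lt_or_ge s (t + 1) with h | h
          · exact hexit s hs h
          · exact (hfull s h hsd).trans (hz.used_le s)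
      · exact absurd hexit.1 (by simp)

/-- The condition `Packed` with the slots after `t` only, the others being not yet treated by
`allocateRLM`. -/
def PackedAfter (T : Fin n → Task) (S : Finset (Fin n)) (C : ℕ) (t : ℕ) (y : Table n)
    (i : Fin n) : Prop :=
  ∀ s, used S y s < C →
    (∀ v, s ≤ v → t < v → v ≤ (T i).deadline → y i v = (T i).bound) ∨ ∀ v < s, y i v = 0

/-- One step of `allocateRLM`: the filled slot `t`, and the removal of as many units of `i` from
the earliest slots. If `i` does not reach full parallelism at `t`, then no unit of `i` remains
before a slot with an idle machine. -/
theorem Filled.trim {t Δ w : ℕ} (hz : Filled T S A C i t Δ true y z w) (hi : i ∈ S)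
    (htd : t ≤ (T i).deadline) (hΔ : Δ = min ((T i).bound - y i t) (before y i t))
    (hk : y i t ≤ (T i).bound)
    (hfull : ∀ s, t ≤ s → s ≤ (T i).deadline → C ≤ used S y s)
    (hloc : LocallyPacked T S C y i) (hafter : PackedAfter T S C t y i) :
    InProgress T S C A i (trim z i w) ∧ LocallyPacked T S C (trim z i w) i ∧
      ∀ t', t = t' + 1 → PackedAfter T S C t' (trim z i w) i := by
  obtain ⟨q, hqt, hwq, hq⟩ := hz.earlier rfl
  have hbefore : ∀ {m}, m ≤ t → before z i m = before y i m := fun hm => hz.before_eq_of_le hm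
  rw [← hbefore hqt] at hwq
  have hidle : ∀ s ≤ (T i).deadline, used S (Malleable.trim z i w) s < C →
      s < t ∧ used S z s < C ∧ used S y s < C := by
    intro s hsd hs
    have h₁ := used_lt_of_used_trim_lt hwq hq hs
    have h₂ := hz.used_le s
    refine ⟨?_, h₁, by omega⟩
    by_contra h
    have := hfull s (by omega) hsd
    omega
  have hzero : ∀ s ≤ t, before y i s ≤ w → ∀ v < s, Malleable.trim z i w i v = 0 :=
    fun s hst hs v hv => trim_eq_zero_of_le (hz.inProgress.apply_zero hi)
      (by rwa [hbefore hst]) hv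
  have hzero' : ∀ s ≤ t, (∀ v < s, y i v = 0) → ∀ v < s, Malleable.trim z i w i v = 0 := by
    refine fun s hst hs => hzero s hst ?_
    have : before y i s = 0 := Finset.sum_eq_zero fun v hv => hs v (Finset.mem_Ico.1 hv).2
    omega
  refine ⟨hz.inProgress.trim hi hwq hq, fun s hsd hs => ?_, ?_⟩
  · obtain ⟨hst, -, hsy⟩ := hidle s hsd hs
    rcases le_or_gt (before z i s) w with h | h
    · rw [hbefore hst.le] at h
      exact .inr (hzero s hst.le h)
    · rw [trim_eq_self_of_le h.le, hz.apply_of_ne s hst.ne]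
      exact (hloc s hsd hsy).imp_right (hzero' s hst.le)
  · rintro t' rfl s hs
    rcases lt_or_ge (T i).deadline s with hsd | hsd
    · exact .inl fun v h₁ _ h₂ => by omega
    obtain ⟨hst, hsz, hsy⟩ := hidle s hsd hs
    rcases hafter s hsy with h | h
    swap
    · exact .inr (hzero' s hst.le h)
    rcases hz.reason with hexit | hexit | hexit
    · rcases le_total ((T i).bound - y i (t' + 1)) (before y i (t' + 1)) with hc | hc
      · left
        intro v hsv htv hvd
        rw [trim_eq_self_of_le (hwq.trans (before_mono (hqt.trans htv)))]
        rcases eq_or_ne v (t' + 1) with rfl | hv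
        · rw [hz.apply_self]
          omega
        · rw [hz.apply_of_ne v hv]
          exact h v hsv (by omega) hvd
      · refine .inr (hzero s hst.le ?_)
        have := before_mono (y := y) (i := i) hst.le
        omega
    · rcases Nat.eq_zero_or_pos s with rfl | hs₁
      · exact .inr (by simp)
      · have := hexit s hs₁ hst
        omega
    · exact .inr (hzero s hst.le (hexit.2 s hst hsz))

theorem ensures_allocateRLM (hi : i ∈ S) {t : ℕ} (htd : t ≤ (T i).deadline)
    (hy : InProgress T S C A i y) (hloc : LocallyPacked T S C y i)
    (hD : before y i ((T i).deadline + 1) = (T i).workload)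
    (hafter : PackedAfter T S C t y i) :
    Ensures (allocateRLM T S C i t) y fun _ y' => InProgress T S C A i y' ∧
      Packed T S C y' i ∧ before y' i ((T i).deadline + 1) = (T i).workload := by
  induction t generalizing y with
  | zero =>
    refine ensures_tick.2 ⟨hy, fun s hs => ?_, hD⟩
    rcases Nat.eq_zero_or_pos s with rfl | hs₁
    · exact .inr (by simp)
    · exact (hafter s hs).imp_left fun h v hsv hvd => h v hsv (by omega) hvd
  | succ t ih =>
    simp only [allocateRLM, ensures_bind, ensures_sumSlots, ensures_tick, zero_add]
    change Ensures (if 0 < before y i (t + 1) then _ else _) y _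
    split_ifs with hpos
    swap
    · refine ensures_pure.2 ⟨hy, fun s hs => ?_, hD⟩
      rcases le_or_gt s (t + 1) with hst | hst
      · right
        intro v hv
        rcases Nat.eq_zero_or_pos v with rfl | hv₁
        · exact hy.apply_zero hi
        · exact eq_zero_of_before_eq_zero (m := t + 1) (by omega)
            (Finset.mem_Ico.2 ⟨hv₁, by omega⟩)
      · exact (hafter s hs).imp_left fun h v hsv hvd => h v hsv (by omega) hvd
    simp only [ensures_bind, ensures_read, ensures_tick]
    change Ensures (if 0 < min ((T i).bound - y i (t + 1)) (before y i (t + 1)) then _ else _) y _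
    have hyk := hy.parallelism i hi (t + 1)
    split_ifs with hΔ
    swap
    · refine ih (by omega) hy hloc hD fun s hs => (hafter s hs).imp_left fun h v hsv htv hvd => ?_
      rcases eq_or_ne v (t + 1) with rfl | hv
      · omega
      · exact h v hsv (by omega) hvd
    simp only [ensures_bind, ensures_avail, ensures_read, ensures_tick, ensures_write]
    have hfull : ∀ s, t + 1 ≤ s → s ≤ (T i).deadline → C ≤ used S y s := by
      intro s hs hsd
      refine le_trans ?_ (hy.mono (t + 1) s hs hsd)
      by_contra h
      rcases hloc (t + 1) htd (by omega) with h' | h'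
      · omega
      · have : before y i (t + 1) = 0 :=
          Finset.sum_eq_zero fun v hv => h' v (Finset.mem_Ico.1 hv).2
        omega
    refine (ensures_routine (A := A) hi htd ?_ hy hfull
      fun s hs hs₁ hsC hb => ?_).mono fun _ y' hz => ?_
    · change y i (t + 1) + min ((T i).bound - y i (t + 1)) (before y i (t + 1)) ≤ _
      omega
    · refine (hloc s (by omega) hsC).resolve_right fun h => ?_
      have : before y i s = 0 := Finset.sum_eq_zero fun v hv => h v (Finset.mem_Ico.1 hv).2
      have := hb rfl
      omega
    generalize Function.update y' i _ = z at hz ⊢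
    generalize C - used S y' (t + 1) = w at hz ⊢
    have htrim := hz.trim hi htd rfl hyk hfull hloc hafter
    have hbefore := hz.before_eq (m := (T i).deadline + 1)
      (Finset.mem_Ico.2 ⟨by omega, by omega⟩)
    refine ensures_removeEarliest (hz.inProgress.apply_zero hi) (by omega) ?_
    refine ih (by omega) htrim.1 htrim.2.1 ?_ (htrim.2.2 t rfl)
    rw [before_trim]
    omega

theorem Good.anti {d d' : ℕ} (hy : Good T S C A d y) (h : d' ≤ d) : Good T S C A d' y :=
  { hy with mono := fun v s hvs hs => hy.mono v s hvs (hs.trans h) }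

theorem Good.utilized (hy : Good T S C A (T i).deadline y) (hi : i ∈ S) (hiA : i ∉ A) :
    Utilized T S A C i (T i).deadline y := by
  have hzero := hy.unstarted i hi hiA
  have hbefore : ∀ m, before y i m = 0 := fun m => Finset.sum_eq_zero fun v _ => hzero v
  have herase : ∀ v, used (S.erase i) y v = used S y v := fun v => by
    rw [used_eq_erase_add hi, hzero, add_zero]
  refine ⟨{ hy.toValid with
      completed := fun j hj _ => hy.completed j hj
      unstarted := fun j hj _ => hy.unstarted j hj
      packed := fun j hj _ => hy.packed j hj
      mono := hy.mono
      mono_erase := fun v s hvs hsd _ => ?_ }, fun v _ => hzero v,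
    fun s _ _ => .inr fun v _ => hzero v, by rw [hbefore]; exact Nat.zero_le _,
    .inr fun s h₁ h₂ => by omega⟩
  rw [herase, herase]
  exact hy.mono v s hvs hsd

theorem ensures_allocateB (hB : ∀ u, forced T S u ≤ C * u) (hi : i ∈ S) (hiA : i ∉ A)
    (hy : Good T S C A (T i).deadline y) :
    Ensures (allocateB T S C i) y fun _ y' => Good T S C (insert i A) (T i).deadline y' := by
  simp only [allocateB, fullyAllocate, ensures_bind, ensures_sumSlots, ensures_tick]
  refine (ensures_fullyUtilize hi le_rfl (hy.utilized hi hiA)).mono fun _ y₁ h₁ => ?_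
  have hsum : ∑ v ∈ Finset.Ico (0 + 1) (0 + (T i).deadline + 1), y₁ i v =
      before y₁ i ((T i).deadline + 1) := by rw [zero_add, zero_add]; rfl
  rw [hsum]
  have hle := h₁.before_le
  refine (ensures_fullyAllocateLoop hi hB le_rfl h₁.inProgress h₁.locallyPacked (by omega)
    (fun hpos s hs => ?_) (fun _ s hs hsd => by omega)).mono ?_
  · rcases h₁.short with h | h
    · omega
    · exact h s hs
  rintro - y₂ ⟨h₂, hloc, hD⟩
  refine (ensures_allocateRLM hi le_rfl h₂ hloc hD
    fun s _ => .inl fun v _ h h' => by omega).mono ?_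
  rintro - y₃ ⟨h₃, hpacked, hD⟩
  refine { h₃.toValid with
    completed := fun j hj hjA => ?_
    unstarted := fun j hj hjA => ?_
    packed := fun j hj => ?_
    mono := h₃.mono }
  · rcases eq_or_ne j i with rfl | hji
    · exact hD
    · exact h₃.completed j hj hji (Finset.mem_of_mem_insert_of_ne hjA hji)
  · rw [Finset.mem_insert, not_or] at hjA
    exact h₃.unstarted j hj hjA.1 hjA.2
  · rcases eq_or_ne j i with rfl | hji
    · exact hpacked
    · exact h₃.packed j hj hji

theorem ensures_allocateAll (hB : ∀ u, forced T S u ≤ C * u) {d : ℕ} {l : List (Fin n)}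
    (hl : l.Nodup) (hlS : ∀ i ∈ l, i ∈ S ∧ i ∉ A ∧ (T i).deadline = d)
    (hy : Good T S C A d y) :
    Ensures (allocateAll T S C l) y fun _ y' => Good T S C (A ∪ l.toFinset) d y' := by
  induction l generalizing A y with
  | nil => simpa [allocateAll, ensures_tick] using hy
  | cons i l ih =>
    obtain ⟨hiS, hiA, rfl⟩ := hlS i (by simp)
    rw [List.nodup_cons] at hl
    simp only [allocateAll, ensures_bind, ensures_tick]
    refine (ensures_allocateB hB hiS hiA hy).mono fun _ y' hy' => ?_
    have h := ih (A := insert i A) hl.2 (fun j hj => ?_) hy'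
    · rwa [Finset.insert_union, ← Finset.union_insert, ← List.toFinset_cons] at h
    · obtain ⟨h₁, h₂, h₃⟩ := hlS j (by simp [hj])
      refine ⟨h₁, ?_, h₃⟩
      rw [Finset.mem_insert, not_or]
      exact ⟨fun h => hl.1 (h ▸ hj), h₂⟩

theorem ensures_ldfLoop (hB : ∀ u, forced T S u ≤ C * u) {m : ℕ} (hm : m ≤ numDeadlines T)
    (hA : ∀ j ∈ S, j ∈ A ↔ tau T m < (T j).deadline) (hy : Good T S C A (tau T m) y) :
    Ensures (ldfLoop T S C m) y fun _ y' => Good T S C S 0 y' := by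
  induction m generalizing A y with
  | zero =>
    refine ensures_tick.2 { hy with
      completed := fun j hj _ => hy.completed j hj ((hA j hj).2 (T j).deadline_pos)
      unstarted := fun j hj h => absurd hj h }
  | succ m ih =>
    simp only [ldfLoop, ensures_bind, ensures_tick, ensures_listing, ensures_withDeadline]
    rintro l hl rfl
    refine (ensures_allocateAll hB (hl.filter _) (fun i hi => ?_) hy).mono fun _ y' hy' =>
      ih (by omega) (fun j hj => ?_) (hy'.anti (tau_le_tau (Nat.le_succ m) hm))
    · simp only [List.mem_filter, decide_eq_true_eq] at hi
      have hi' := List.mem_toFinset.2 hi.1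
      exact ⟨hi', fun h => ((hA i hi').1 h).ne' hi.2, hi.2⟩
    · have h₁ := tau_lt_tau (Nat.lt_succ_self m) hm
      have h₂ := deadline_le_or_ge (T := T) hm j
      simp only [Finset.mem_union, hA j hj, List.mem_toFinset, List.mem_filter,
        decide_eq_true_eq, List.mem_toFinset.1 hj, true_and]
      simp only [Nat.succ_eq_add_one] at h₁
      omega

theorem Good.feasible {d : ℕ} (hy : Good T S C S d y) : Feasible T S C y where
  window := hy.window
  parallelism := hy.parallelism
  completed j hj := by
    rw [← Finset.Ico_add_one_right_eq_Icc]
    exact (hy.completed j hj hj).ge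
  capacity := hy.capacity

theorem feasible_of_mem_ldfRuns (hB : Boundary T S C) {r : Outcome n Unit}
    (hr : r ∈ ldfRuns T S C) : Feasible T S C r.table := by
  have hstart : Good T S C ∅ (tau T (numDeadlines T)) fun _ _ => 0 :=
    { window := fun _ _ _ _ => rfl
      parallelism := fun _ _ _ => Nat.zero_le _
      capacity := fun _ => by simp [used]
      completed := fun _ _ h => absurd h (Finset.notMem_empty _)
      unstarted := fun _ _ _ _ => rfl
      packed := fun _ _ _ _ => .inr fun _ _ => rfl
      mono := fun _ _ _ _ => le_rfl }
  refine (ensures_ldfLoop (forced_le_of_boundary hB) le_rfl (fun j _ => ?_) hstart r hr).feasible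
  simpa using deadline_le_tau j

end LDF

end Malleable

theorem theorem1 :
    (∀ (n : ℕ) (T : Fin n → Malleable.Task) (S : Finset (Fin n)) (C : ℕ),
      -- the boundary condition is necessary for the existence of any feasible schedule
      ((∃ y, Malleable.Feasible T S C y) → Malleable.Boundary T S C) ∧
      -- LDF has a run, whatever the input
      (Malleable.ldfRuns T S C).Nonempty ∧
      -- LDF schedules S feasibly, however its free choices are made, iff the condition holds
      ((∀ r ∈ Malleable.ldfRuns T S C, Malleable.Feasible T S C r.table) ↔
        Malleable.Boundary T S C) ∧
      -- some run of LDF schedules S feasibly iff the condition holds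
      ((∃ r ∈ Malleable.ldfRuns T S C, Malleable.Feasible T S C r.table) ↔
        Malleable.Boundary T S C) ∧
      -- optimality: LDF schedules S feasibly whenever a feasible schedule exists
      ((∃ y, Malleable.Feasible T S C y) →
        ∀ r ∈ Malleable.ldfRuns T S C, Malleable.Feasible T S C r.table)) ∧
    -- running time O(|S|²), for bounded deadlines and parallelism bounds
    (∀ d k : ℕ, ∃ K : ℕ, ∀ (n : ℕ) (T : Fin n → Malleable.Task) (S : Finset (Fin n)) (C : ℕ),
      (∀ i, (T i).deadline ≤ d) → (∀ i, (T i).bound ≤ k) → S.Nonempty →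
        ∀ r ∈ Malleable.ldfRuns T S C, r.time ≤ K * S.card ^ 2) := by
  refine ⟨fun n T S C => ?_, fun d k =>
    ⟨_, fun n T S C hd hk hS r hr => Malleable.time_le hd hk hS hr⟩⟩
  have hnec : ∀ {y}, Malleable.Feasible T S C y → Malleable.Boundary T S C := fun hy =>
    Malleable.boundary_of_forced_le hy.forced_le
  have hsuf : Malleable.Boundary T S C →
      ∀ r ∈ Malleable.ldfRuns T S C, Malleable.Feasible T S C r.table :=
    fun hB _ hr => Malleable.feasible_of_mem_ldfRuns hB hr
  obtain ⟨r₀, hr₀⟩ := Malleable.ldfRuns_nonempty T S C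
  exact ⟨fun ⟨_, hy⟩ => hnec hy, ⟨r₀, hr₀⟩, ⟨fun h => hnec (h r₀ hr₀), hsuf⟩,
    ⟨fun ⟨_, _, h⟩ => hnec h, fun hB => ⟨r₀, hr₀, hsuf hB r₀ hr₀⟩⟩,
    fun ⟨_, hy⟩ => hsuf (hnec hy)⟩
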